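/- Let $K$ be an algebraically closed field of characteristic $p\ge 0$, let $S=\bigoplus_{d\in\mathbb N^r}S_d$ be a commutative, finitely generated, $\mathbb N^r$-graded $K$-algebra with $S_0=K$ (and $S \neq 0$), and let $G$ be a finite group acting on $S$ by $K$-algebra automorphisms that preserve the grading. Let $R=S^G$, with $R_d=R\cap S_d$. For a homogeneous ideal $N\subseteq R$ put $H(N,t)=\sum_{d}\dim_K(N\cap R_d)\,t^d$, where $t=(t_1,\dots,t_r)$. The universal denominator $\operatorname{udenom}(R,t)$ is the smallest polynomial $B(t)\in\mathbb Z[t_1,\dots,t_r]$ with respect to divisibility such that $B(0)=1$ and $B(t)H(N,t)$ is a Laurent polynomial for every homogeneous ideal $N\subseteq R$. For $n\ge 1$ let $\phi_n$ be the $n$-th cyclotomic polynomial, with sign chosen such that $\phi_n(0)=1$; for $0\ne d\in\mathbb N^r$ with $k=\gcd(d_1,\dots,d_r)$ let $\phi_d(t)=\phi_k(t^{d/k})$, and let $\phi_0=1$. Let $Y=\operatorname{Hom}_{K\text{-alg}}(S,K)$ be the affine variety of $S$, with the action $(g\cdot y)(f)=y(g^{-1}\cdot f)$ of $G$ and the action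 of the torus $T=(K^*)^r$ given by $(t\cdot y)(f)=t^{-e}y(f)$ for $f\in S_e$. For $d\in\mathbb N^r$ let $T^{[d]}=\{t\in T\mid t^d=1\}$, and for $g\in G$, $\zeta\in T$ let $Y^g_\zeta=\{y\in Y\mid g\cdot y=\zeta\cdot y\}$. Then $\operatorname{udenom}(S^G,t)$ exists and can be written as $\prod_{d\in\mathbb N^r}\phi_d(t)^{m_d}$ with $m_d\in\mathbb N$, almost all zero. For every such expression, every $d\in\mathbb N^r$ that is not divisible by $p$ (that is, $p\nmid d_i$ for some $i$; when $p=0$ this means $d\neq 0$), and every $\zeta\in T^{[d]}$ that generates a Zariski dense subgroup of $T^{[d]}$, one has $$m_d=\max_{g\in G}\dim Y^g_\zeta .$$ -/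

import Mathlib

open scoped BigOperators

noncomputable section

namespace UDenom

/-! ### Hilbert series and universal denominators -/

section Hilbert

variable {K R : Type*} [Field K] [CommRing R] [Algebra K R] {r : ℕ}

/-- The Hilbert series of an ideal `N` of an `ℕ^r`-graded `K`-algebra `R`: the coefficient of
`t^d` is `dim_K (N ∩ R_d)`. -/
def hilbertSeries (𝓡 : (Fin r →₀ ℕ) → Submodule K R) (N : Ideal R) :
    MvPowerSeries (Fin r) ℤ :=
  fun d => (Module.finrank K ↥(N.restrictScalars K ⊓ 𝓡 d) : ℤ)

/-- `B(0) = 1`, and `B(t) H(N,t)` is a Laurent polynomial for every graded submodule `N` of `R`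
(that is, every homogeneous ideal). As `R` is graded by `ℕ^r`, `B(t) H(N,t)` is a power series,
so it is a Laurent polynomial exactly if it is a polynomial. -/
structure ClearsDenominators (𝓡 : (Fin r →₀ ℕ) → Submodule K R) [GradedAlgebra 𝓡]
    (B : MvPolynomial (Fin r) ℤ) : Prop where
  constantCoeff_eq_one : MvPolynomial.constantCoeff B = 1
  exists_polynomial : ∀ N : Ideal R, N.IsHomogeneous 𝓡 →
    ∃ A : MvPolynomial (Fin r) ℤ,
      (B : MvPowerSeries (Fin r) ℤ) * hilbertSeries 𝓡 N = (A : MvPowerSeries (Fin r) ℤ)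

/-- `B` is the universal denominator of `R` (as a graded module over itself): the smallest
polynomial, with respect to divisibility, that clears all denominators. -/
structure IsUDenom (𝓡 : (Fin r →₀ ℕ) → Submodule K R) [GradedAlgebra 𝓡]
    (B : MvPolynomial (Fin r) ℤ) : Prop where
  clears : ClearsDenominators 𝓡 B
  dvd_of_clears : ∀ B' : MvPolynomial (Fin r) ℤ, ClearsDenominators 𝓡 B' → B ∣ B'

end Hilbert

/-! ### The polynomials `φ_d` -/

/-- The `n`-th cyclotomic polynomial, with the sign that makes the constant term `1`. -/
def phiOne (n : ℕ) : Polynomial ℤ :=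
  if n = 1 then 1 - Polynomial.X else Polynomial.cyclotomic n ℤ

/-- The greatest common divisor of the entries of `d`. -/
def vecGcd {r : ℕ} (d : Fin r →₀ ℕ) : ℕ := Finset.univ.gcd d

/-- `φ_d(t) = φ_k(t^{d/k})` with `k = gcd(d_1,…,d_r)`; by convention `φ_0 = 1`. -/
def phi {r : ℕ} (d : Fin r →₀ ℕ) : MvPolynomial (Fin r) ℤ :=
  Polynomial.aeval
    (MvPolynomial.monomial (d.mapRange (fun a => a / vecGcd d) (Nat.zero_div _)) (1 : ℤ))
    (phiOne (vecGcd d))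

/-! ### The torus -/

section Torus

variable {K : Type*} [Field K] {r : ℕ}

/-- The character `t ↦ t^d` of the torus `(K^*)^r`. -/
def character (d : Fin r →₀ ℕ) : (Fin r → Kˣ) →* Kˣ where
  toFun t := ∏ i, t i ^ d i
  map_one' := by simp
  map_mul' s t := by simp [mul_pow, Finset.prod_mul_distrib]

/-- The kernel `T^{[d]}` of the character `t ↦ t^d`. -/
def torusKer (K : Type*) [Field K] {r : ℕ} (d : Fin r →₀ ℕ) : Subgroup (Fin r → Kˣ) :=
  (character d).ker

/-- The Zariski closure in the torus `T = (K^*)^r` of a subset. The Zariski topology of `T` is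
induced by that of the affine space `K^r`. -/
def zariskiClosure (A : Set (Fin r → Kˣ)) : Set (Fin r → Kˣ) :=
  {t | ∀ P : MvPolynomial (Fin r) K,
    (∀ s ∈ A, MvPolynomial.eval (fun i => (s i : K)) P = 0) →
      MvPolynomial.eval (fun i => (t i : K)) P = 0}

/-- `ζ` lies in `T^{[d]}` and generates a Zariski dense subgroup of it. -/
def GeneratesDense (d : Fin r →₀ ℕ) (ζ : Fin r → Kˣ) : Prop :=
  ζ ∈ torusKer K d ∧
    zariskiClosure (Subgroup.zpowers ζ : Set (Fin r → Kˣ)) = (torusKer K d : Set (Fin r → Kˣ))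

end Torus

/-! ### The affine variety of a graded algebra -/

section Variety

variable {K S : Type*} [Field K] [CommRing S] [Algebra K S] {r : ℕ}

/-- The action of `t` in the torus on `S`: multiplication by `t^e` on the component `S_e`. -/
def torusAct (𝒜 : (Fin r →₀ ℕ) → Submodule K S) [GradedAlgebra 𝒜] (t : Fin r → Kˣ) :
    S →ₐ[K] S :=
  (DirectSum.toAlgebra K (fun e => 𝒜 e)
    (fun e => ((character e t : Kˣ) : K) • (𝒜 e).subtype)
    (by simp [character])
    (by
      intro i j a b
      simp [character, pow_add, Finset.prod_mul_distrib, smul_smul, mul_comm])).comp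
    (DirectSum.decomposeAlgEquiv 𝒜).toAlgHom

theorem torusAct_of_mem (𝒜 : (Fin r →₀ ℕ) → Submodule K S) [GradedAlgebra 𝒜]
    (t : Fin r → Kˣ) {e : Fin r →₀ ℕ} {f : S} (hf : f ∈ 𝒜 e) :
    torusAct 𝒜 t f = ((character e t : Kˣ) : K) • f := by
  simp only [torusAct, AlgHom.comp_apply]
  change (DirectSum.toAlgebra K _ _ _ _) (DirectSum.decompose 𝒜 f) = _
  rw [DirectSum.decompose_of_mem 𝒜 hf]
  exact DirectSum.toAddMonoid_of
    (fun e => (((character e t : Kˣ) : K) • (𝒜 e).subtype).toAddMonoidHom) e ⟨f, hf⟩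

/-- The action of the torus on the points of `Y`, `(t · y)(f) = y(t⁻¹ · f)`. A point of the
affine variety `Y` of `S` is a `K`-algebra homomorphism `S → K`. -/
def torusPoint (𝒜 : (Fin r →₀ ℕ) → Submodule K S) [GradedAlgebra 𝒜] (t : Fin r → Kˣ)
    (y : S →ₐ[K] K) : S →ₐ[K] K :=
  y.comp (torusAct 𝒜 t⁻¹)

/-- The action of a group on the points of `Y`, `(g · y)(f) = y(g⁻¹ · f)`. -/
def groupPoint {G : Type*} [Group G] [MulSemiringAction G S] [SMulCommClass G K S] (g : G)
    (y : S →ₐ[K] K) : S →ₐ[K] K :=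
  y.comp (MulSemiringAction.toAlgHom K S g⁻¹)

/-- The set `Y^g_ζ = {y ∈ Y | g · y = ζ · y}`. -/
def eigenLocus {G : Type*} [Group G] [MulSemiringAction G S] [SMulCommClass G K S]
    (𝒜 : (Fin r →₀ ℕ) → Submodule K S) [GradedAlgebra 𝒜] (g : G) (ζ : Fin r → Kˣ) :
    Set (S →ₐ[K] K) :=
  {y | groupPoint g y = torusPoint 𝒜 ζ y}

/-- The ideal of all functions in `S` that vanish on a set of points. -/
def vanishingIdeal (Z : Set (S →ₐ[K] K)) : Ideal S :=
  ⨅ y ∈ Z, RingHom.ker y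

/-- The dimension of (the Zariski closure of) a set `Z` of points: the Krull dimension of its
coordinate ring. -/
def algDim (Z : Set (S →ₐ[K] K)) : WithBot ℕ∞ :=
  ringKrullDim (S ⧸ vanishingIdeal Z)

end Variety

/-! ### The invariant ring -/

section Invariants

variable (G : Type*) {K S : Type*} [Field K] [CommRing S] [Algebra K S] [Group G]
  [MulSemiringAction G S] [SMulCommClass G K S] {r : ℕ}

/-- The action of `G` respects the grading. -/
class GradedAction (𝒜 : (Fin r →₀ ℕ) → Submodule K S) : Prop where
  smul_mem : ∀ (g : G) (d : Fin r →₀ ℕ) (f : S), f ∈ 𝒜 d → g • f ∈ 𝒜 d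

/-- The graded pieces `(S^G)_d = S^G ∩ S_d` of the invariant ring `S^G`. -/
def invGrading (𝒜 : (Fin r →₀ ℕ) → Submodule K S) (d : Fin r →₀ ℕ) :
    Submodule K (FixedPoints.subalgebra K S G) :=
  (𝒜 d).comap (FixedPoints.subalgebra K S G).val.toLinearMap

theorem decompose_smul (𝒜 : (Fin r →₀ ℕ) → Submodule K S) [GradedAlgebra 𝒜]
    [GradedAction G 𝒜] (g : G) (f : S) (d : Fin r →₀ ℕ) :
    (DirectSum.decompose 𝒜 (g • f) d : S) = g • (DirectSum.decompose 𝒜 f d : S) := by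
  induction f using DirectSum.Decomposition.inductionOn 𝒜 with
  | zero => simp
  | @homogeneous e m =>
    have h : g • (m : S) ∈ 𝒜 e := GradedAction.smul_mem g e _ m.2
    by_cases hed : e = d
    · subst hed
      rw [DirectSum.decompose_of_mem_same 𝒜 h, DirectSum.decompose_of_mem_same 𝒜 m.2]
    · rw [DirectSum.decompose_of_mem_ne 𝒜 h hed, DirectSum.decompose_of_mem_ne 𝒜 m.2 hed,
        smul_zero]
  | add a b ha hb => simp [smul_add, DirectSum.decompose_add, ha, hb]

theorem decompose_mem (𝒜 : (Fin r →₀ ℕ) → Submodule K S) [GradedAlgebra 𝒜]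
    [GradedAction G 𝒜] (f : FixedPoints.subalgebra K S G) (d : Fin r →₀ ℕ) :
    (DirectSum.decompose 𝒜 (f : S) d : S) ∈ FixedPoints.subalgebra K S G := by
  intro g
  rw [← decompose_smul G 𝒜 g (f : S) d, f.2 g]

instance invGrading_gradedMonoid (𝒜 : (Fin r →₀ ℕ) → Submodule K S) [GradedAlgebra 𝒜] :
    SetLike.GradedMonoid (invGrading G 𝒜) where
  one_mem := SetLike.GradedOne.one_mem (A := 𝒜)
  mul_mem _ _ _ _ ha hb := SetLike.GradedMul.mul_mem (A := 𝒜) ha hb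

theorem invGrading_isInternal (𝒜 : (Fin r →₀ ℕ) → Submodule K S) [GradedAlgebra 𝒜]
    [GradedAction G 𝒜] : DirectSum.IsInternal (invGrading G 𝒜) := by
  have key : ∀ (x : DirectSum (Fin r →₀ ℕ) fun d => invGrading G 𝒜 d) (d : Fin r →₀ ℕ),
      ((x d : FixedPoints.subalgebra K S G) : S) =
        DirectSum.decompose 𝒜 ((DirectSum.coeAddMonoidHom (invGrading G 𝒜) x :
          FixedPoints.subalgebra K S G) : S) d := by
    intro x d
    induction x using DirectSum.induction_on with
    | zero => simp
    | of e y =>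
      have hy : ((y : FixedPoints.subalgebra K S G) : S) ∈ 𝒜 e := y.2
      rw [DirectSum.coeAddMonoidHom_of]
      by_cases hed : e = d
      · subst hed
        rw [DirectSum.of_eq_same, DirectSum.decompose_of_mem_same 𝒜 hy]
      · rw [DirectSum.of_eq_of_ne _ _ _ (Ne.symm hed), DirectSum.decompose_of_mem_ne 𝒜 hy hed]
        rfl
    | add a b ha hb => simp [DirectSum.decompose_add, ha, hb]
  constructor
  · intro x y hxy
    refine DFinsupp.ext fun d => Subtype.ext (Subtype.ext ?_)
    rw [key x d, key y d, hxy]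
  · intro f
    classical
    refine ⟨∑ d ∈ (DirectSum.decompose 𝒜 (f : S)).support,
      DirectSum.of (fun d => invGrading G 𝒜 d) d
        ⟨⟨_, decompose_mem G 𝒜 f d⟩, (DirectSum.decompose 𝒜 (f : S) d).2⟩, ?_⟩
    apply Subtype.ext
    rw [map_sum]
    simp only [DirectSum.coeAddMonoidHom_of, AddSubmonoidClass.coe_finsetSum]
    exact DirectSum.sum_support_decompose 𝒜 (f : S)

/-- The grading of the invariant ring. -/
instance invGrading_gradedAlgebra (𝒜 : (Fin r →₀ ℕ) → Submodule K S) [GradedAlgebra 𝒜]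
    [GradedAction G 𝒜] : GradedAlgebra (invGrading G 𝒜) where
  toDecomposition := (invGrading_isInternal G 𝒜).chooseDecomposition

end Invariants

end UDenom

end

/-!
Let `R` be a finitely generated `ℕ^r`-graded algebra with finite-dimensional pieces, and let
`offLine d` be the ideal generated by the homogeneous elements whose degree is not a multiple of
`d`. For a homogeneous ideal `I`, the Hilbert series of `R / I` has along `φ_d = 0` a pole of order
at most the dimension of `R / (I + offLine d)`: this follows by Noetherian induction from
`H(R/I) = H(R/(I + x)) + t^e H(R/(I : x))`, since `φ_d` divides `1 - t^e` if and only if `e` is a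
multiple of `d`, and then exactly once. For `I = offLine d` the bound is attained: algebraically
independent homogeneous elements on the line through `d` bound the coefficients of the series from
below, and these are nonnegative, so that its growth as `t^d → 1` along the reals detects the order
of the pole. Hence the universal denominator is the product of the `φ_d ^ dim (R / offLine d)`.

Now let `R = S^G`. Density of the powers of `ζ` in `T^{[d]}` means that the characters trivial at
`ζ` are the multiples of `d`. Hence a point `y` of `Y` lies over the zero set of `offLine d` if and
only if `ζ · y` and `y` agree on `R`, that is, if and only if `ζ · y = g · y` for some `g` in `G`.
So the union of the `Y^g_ζ` lies over the zero set of `offLine d`, and it has the same dimension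
since `S` is integral over `R`.
-/

noncomputable section

namespace UDenom

section PrimitiveVector

variable {r : ℕ}

/-- A primitive exponent vector, bundled with coefficients of a Bézout relation between its
entries. The coefficients single out one complement of the line through the vector. -/
structure PrimitiveVector (r : ℕ) where
  vec : Fin r →₀ ℕ
  bezout : Fin r → ℤ
  sum_bezout_mul_vec : ∑ i, bezout i * vec i = 1

namespace PrimitiveVector

variable (v : PrimitiveVector r)

/-- The coordinate along `v.vec` of an exponent vector, in the splitting of `ℤ^r` given by the
Bézout relation. -/
def height : (Fin r →₀ ℕ) →+ ℤ :=
  Finsupp.weight v.bezout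

/-- The image of the `i`-th unit vector under the projection of `ℤ^r` along `v.vec`. -/
def transverseUnit (i : Fin r) : Fin r → ℤ :=
  Pi.single i 1 - fun j => v.bezout i * v.vec j

/-- The component transverse to `v.vec` of an exponent vector. -/
def transverse : (Fin r →₀ ℕ) →+ (Fin r → ℤ) :=
  Finsupp.weight v.transverseUnit

theorem height_apply (a : Fin r →₀ ℕ) : v.height a = ∑ i, v.bezout i * a i := by
  simp only [height, Finsupp.weight_eq_sum, nsmul_eq_mul, mul_comm]

theorem transverse_apply (a : Fin r →₀ ℕ) (j : Fin r) :
    v.transverse a j = a j - v.height a * v.vec j := by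
  have hunit (i : Fin r) : (a i • v.transverseUnit i) j =
      (if j = i then (a i : ℤ) else 0) - v.bezout i * a i * v.vec j := by
    simp only [transverseUnit, Pi.smul_apply, Pi.sub_apply, Pi.single_apply, nsmul_eq_mul]
    split_ifs <;> ring
  rw [transverse, Finsupp.weight_eq_sum, Finset.sum_apply, Finset.sum_congr rfl fun i _ => hunit i,
    Finset.sum_sub_distrib, Finset.sum_ite_eq, if_pos (Finset.mem_univ j), height_apply,
    Finset.sum_mul]

@[simp]
theorem height_vec : v.height v.vec = 1 := by
  rw [height_apply, v.sum_bezout_mul_vec]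

@[simp]
theorem transverse_vec : v.transverse v.vec = 0 := by
  ext j
  simp [transverse_apply]

theorem vec_ne_zero : v.vec ≠ 0 := fun h => by
  simpa [h] using v.height_vec

theorem smul_vec_injective : Function.Injective fun k : ℕ => k • v.vec :=
  fun i j h => by simpa using congrArg v.height h

theorem eq_add_smul_vec {a b : Fin r →₀ ℕ} (h : v.transverse a = v.transverse b)
    (hle : v.height b ≤ v.height a) : a = b + (v.height a - v.height b).toNat • v.vec := by
  ext j
  have hj := congrFun h j
  simp only [transverse_apply] at hj
  simp only [Finsupp.add_apply, Finsupp.smul_apply, smul_eq_mul]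
  zify
  rw [Int.toNat_of_nonneg (by linarith)]
  linarith

theorem transverse_eq_zero_iff {a : Fin r →₀ ℕ} :
    v.transverse a = 0 ↔ ∃ n : ℕ, a = n • v.vec := by
  refine ⟨fun h => ?_, fun ⟨n, hn⟩ => by simp [hn]⟩
  rcases le_total 0 (v.height a) with ha | ha
  · exact ⟨_, (v.eq_add_smul_vec (b := 0) (by simpa using h) (by simpa using ha)).trans
      (zero_add _)⟩
  · have h0 := v.eq_add_smul_vec (a := 0) (b := a) (by simpa using h.symm) (by simpa using ha)
    exact ⟨0, by rw [zero_smul]; exact (add_eq_zero.mp h0.symm).1⟩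

theorem mem_multiples_smul_vec_iff {k : ℕ} {a : Fin r →₀ ℕ} :
    a ∈ AddSubmonoid.multiples (k • v.vec) ↔ v.transverse a = 0 ∧ (k : ℤ) ∣ v.height a := by
  rw [transverse_eq_zero_iff, AddSubmonoid.mem_multiples_iff]
  constructor
  · rintro ⟨n, rfl⟩
    exact ⟨⟨n * k, smul_smul _ _ _⟩, by simp⟩
  · rintro ⟨⟨n, rfl⟩, hk⟩
    obtain ⟨m, rfl⟩ : k ∣ n := by simpa [Int.natCast_dvd_natCast] using hk
    exact ⟨m, by rw [smul_smul, mul_comm]⟩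

end PrimitiveVector

theorem natCast_finset_gcd {ι : Type*} (s : Finset ι) (f : ι → ℕ) :
    ((s.gcd f : ℕ) : ℤ) = s.gcd fun i => (f i : ℤ) := by
  classical
  induction s using Finset.induction_on with
  | empty => simp
  | insert i s _ ih =>
    rw [Finset.gcd_insert, Finset.gcd_insert, ← ih, ← Int.coe_gcd, Int.gcd_natCast_natCast]
    rfl

theorem vecGcd_dvd (d : Fin r →₀ ℕ) (i : Fin r) : vecGcd d ∣ d i :=
  Finset.gcd_dvd (Finset.mem_univ i)

theorem vecGcd_pos {d : Fin r →₀ ℕ} (hd : d ≠ 0) : 0 < vecGcd d :=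
  Nat.pos_of_ne_zero fun h => hd <| Finsupp.ext fun i => by
    simpa using Finset.gcd_eq_zero_iff.mp h i (Finset.mem_univ i)

theorem exists_eq_vecGcd_smul_vec {d : Fin r →₀ ℕ} (hd : d ≠ 0) :
    ∃ v : PrimitiveVector r, d = vecGcd d • v.vec := by
  obtain ⟨c, hc⟩ := Finset.gcd_eq_sum_mul (R := ℤ) Finset.univ (fun i => (d i : ℤ))
  rw [← natCast_finset_gcd] at hc
  have hdiv (i : Fin r) : d i = vecGcd d * (d i / vecGcd d) :=
    (Nat.mul_div_cancel' (vecGcd_dvd d i)).symm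
  refine ⟨⟨d.mapRange (fun a => a / vecGcd d) (Nat.zero_div _), c, ?_⟩, ?_⟩
  · have hk : (vecGcd d : ℤ) ≠ 0 := by exact_mod_cast (vecGcd_pos hd).ne'
    refine mul_left_cancel₀ hk ?_
    rw [mul_one, Finset.mul_sum]
    refine (Finset.sum_congr rfl fun i _ => ?_).trans hc.symm
    rw [Finsupp.mapRange_apply]
    conv_rhs => rw [hdiv i]
    push_cast
    ring
  · ext i
    simpa using hdiv i

theorem PrimitiveVector.vecGcd_smul_vec (v : PrimitiveVector r) (k : ℕ) :
    vecGcd (k • v.vec) = k := by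
  have hdvd : (vecGcd v.vec : ℤ) ∣ 1 := by
    rw [← v.sum_bezout_mul_vec]
    exact Finset.dvd_sum fun i _ =>
      dvd_mul_of_dvd_right (Int.natCast_dvd_natCast.mpr (vecGcd_dvd v.vec i)) _
  have hone : vecGcd v.vec = 1 := Nat.dvd_one.mp (by exact_mod_cast hdvd)
  calc vecGcd (k • v.vec) = normalize k * vecGcd v.vec := Finset.gcd_mul_left
    _ = k := by simp [hone]

end PrimitiveVector

section Phi

open MvPolynomial

variable {r : ℕ}

theorem phiOne_dvd_iff {k : ℕ} (hk : 0 < k) {η : ℂ} (hη : IsPrimitiveRoot η k)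
    (q : Polynomial ℤ) : phiOne k ∣ q ↔ Polynomial.aeval η q = 0 := by
  have hcyc : phiOne k ∣ q ↔ Polynomial.cyclotomic k ℤ ∣ q := by
    rw [phiOne]
    split_ifs with hone
    · rw [hone, Polynomial.cyclotomic_one, ← neg_dvd, neg_sub]
    · rfl
  rw [hcyc, Polynomial.cyclotomic_eq_minpoly hη hk,
    minpoly.isIntegrallyClosed_dvd_iff (hη.isIntegral hk)]

namespace PrimitiveVector

variable (v : PrimitiveVector r)

theorem phi_smul_vec (k : ℕ) :
    phi (k • v.vec) = Polynomial.aeval (monomial v.vec (1 : ℤ)) (phiOne k) := by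
  simp only [phi, v.vecGcd_smul_vec]
  rcases Nat.eq_zero_or_pos k with rfl | hk
  · simp [phiOne]
  · have hdiv : (k • v.vec).mapRange (fun a => a / k) (Nat.zero_div _) = v.vec := by
      ext i
      simp [Nat.mul_div_cancel_left _ hk]
    rw [hdiv]

/-- Evaluation of a polynomial at the generic point of the translate `t^v = η` of the subtorus
`t^v = 1`. The coordinate ring of that translate is the group algebra of the lattice of transverse
components. -/
def genericEval (η : ℂˣ) : MvPolynomial (Fin r) ℤ →ₐ[ℤ] AddMonoidAlgebra ℂ (Fin r → ℤ) :=
  aeval fun i => AddMonoidAlgebra.single (v.transverseUnit i) ((η ^ v.bezout i : ℂˣ) : ℂ)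

theorem genericEval_monomial (η : ℂˣ) (a : Fin r →₀ ℕ) :
    v.genericEval η (monomial a 1) =
      AddMonoidAlgebra.single (v.transverse a) ((η ^ v.height a : ℂˣ) : ℂ) := by
  induction a using Finsupp.induction_linear with
  | zero =>
    rw [monomial_zero', map_one, map_one, map_zero, map_zero, zpow_zero, Units.val_one,
      AddMonoidAlgebra.one_def]
  | add a b ha hb =>
    rw [← mul_one (1 : ℤ), ← monomial_mul, map_mul, ha, hb, AddMonoidAlgebra.single_mul_single,
      map_add, map_add, zpow_add, Units.val_mul]
  | single i n =>
    rw [← X_pow_eq_monomial, map_pow, genericEval, aeval_X, AddMonoidAlgebra.single_pow,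
      transverse, height, Finsupp.weight_single, Finsupp.weight_single,
      nsmul_eq_mul n (v.bezout i), mul_comm, zpow_mul, zpow_natCast, Units.val_pow_eq_pow_val]

theorem genericEval_aeval_monomial (η : ℂˣ) (q : Polynomial ℤ) :
    v.genericEval η (Polynomial.aeval (monomial v.vec (1 : ℤ)) q) =
      AddMonoidAlgebra.single 0 (Polynomial.aeval (η : ℂ) q) := by
  have hη : v.genericEval η (monomial v.vec 1) =
      AddMonoidAlgebra.singleZeroAlgHom (R := ℤ) (A := ℂ) (M := Fin r → ℤ) (η : ℂ) := by
    rw [genericEval_monomial, transverse_vec, height_vec, zpow_one]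
    rfl
  rw [← Polynomial.aeval_algHom_apply, hη, Polynomial.aeval_algHom_apply]
  rfl

theorem genericEval_weightedHomogeneousComponent (η : ℂˣ) (x : Fin r → ℤ)
    (f : MvPolynomial (Fin r) ℤ) :
    v.genericEval η (weightedHomogeneousComponent v.transverseUnit x f) =
      AddMonoidAlgebra.single x ((v.genericEval η f).coeff x) := by
  classical
  induction f using MvPolynomial.induction_on' with
  | monomial a z =>
    have hz : monomial a z = z • monomial a (1 : ℤ) := by simp [smul_monomial]
    rw [weightedHomogeneousComponent_of_mem (isWeightedHomogeneous_monomial _ a z rfl), hz]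
    split_ifs with h
    · rw [map_smul, genericEval_monomial, h]
      simp [transverse]
    · rw [map_smul, genericEval_monomial]
      simp [transverse, Ne.symm h]
  | add p q hp hq =>
    simp only [map_add, hp, hq, AddMonoidAlgebra.coeff_add, Finsupp.add_apply,
      AddMonoidAlgebra.single_add]

theorem exists_eq_monomial_mul_aeval {f : MvPolynomial (Fin r) ℤ} {x : Fin r → ℤ}
    (hf : f.IsWeightedHomogeneous v.transverseUnit x) :
    ∃ (b : Fin r →₀ ℕ) (g : Polynomial ℤ),
      f = monomial b 1 * Polynomial.aeval (monomial v.vec (1 : ℤ)) g := by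
  rcases eq_or_ne f 0 with rfl | hne
  · exact ⟨0, 0, by simp⟩
  obtain ⟨b, hb, hmin⟩ := f.support.exists_min_image v.height (support_nonempty.mpr hne)
  have hx (a) (ha : a ∈ f.support) : v.transverse a = x := hf (mem_support_iff.mp ha)
  let n (a : Fin r →₀ ℕ) : ℕ := (v.height a - v.height b).toNat
  refine ⟨b, ∑ a ∈ f.support, Polynomial.C (f.coeff a) * Polynomial.X ^ n a, ?_⟩
  conv_lhs => rw [f.as_sum]
  rw [map_sum, Finset.mul_sum]
  refine Finset.sum_congr rfl fun a ha => ?_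
  have hab : b + n a • v.vec = a :=
    (v.eq_add_smul_vec ((hx a ha).trans (hx b hb).symm) (hmin a ha)).symm
  rw [map_mul, map_pow, Polynomial.aeval_X, Polynomial.aeval_C, monomial_pow, one_pow,
    algebraMap_eq, C_mul_monomial, monomial_mul, one_mul, mul_one, hab]

theorem phi_dvd_iff_genericEval_eq_zero {k : ℕ} (hk : 0 < k) {η : ℂˣ}
    (hη : IsPrimitiveRoot (η : ℂ) k) (f : MvPolynomial (Fin r) ℤ) :
    phi (k • v.vec) ∣ f ↔ v.genericEval η f = 0 := by
  rw [phi_smul_vec]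
  constructor
  · rintro ⟨g, rfl⟩
    rw [map_mul, genericEval_aeval_monomial, (phiOne_dvd_iff hk hη _).mp dvd_rfl,
      AddMonoidAlgebra.single_zero, zero_mul]
  intro hf
  rw [← finsum_weightedHomogeneousComponent v.transverseUnit f]
  refine finsum_induction _ (dvd_zero _) (fun _ _ => dvd_add) fun x => ?_
  obtain ⟨b, g, hg⟩ := v.exists_eq_monomial_mul_aeval
    (weightedHomogeneousComponent_isWeightedHomogeneous (w := v.transverseUnit) x f)
  have hzero := v.genericEval_weightedHomogeneousComponent η x f
  rw [hf, hg, map_mul, genericEval_monomial, genericEval_aeval_monomial,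
    AddMonoidAlgebra.single_mul_single, AddMonoidAlgebra.coeff_zero, Finsupp.zero_apply,
    AddMonoidAlgebra.single_zero, AddMonoidAlgebra.single_eq_zero] at hzero
  rw [hg]
  exact dvd_mul_of_dvd_right
    (map_dvd _ ((phiOne_dvd_iff hk hη g).mpr ((Units.mul_right_eq_zero _).mp hzero))) _

end PrimitiveVector

theorem exists_primitiveVector {d : Fin r →₀ ℕ} (hd : d ≠ 0) :
    ∃ (v : PrimitiveVector r) (k : ℕ) (η : ℂˣ),
      0 < k ∧ d = k • v.vec ∧ IsPrimitiveRoot (η : ℂ) k := by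
  obtain ⟨v, hv⟩ := exists_eq_vecGcd_smul_vec hd
  have hk := vecGcd_pos hd
  have hη := Complex.isPrimitiveRoot_exp (vecGcd d) hk.ne'
  exact ⟨v, vecGcd d, (hη.isUnit hk.ne').unit, hk, hv, hη⟩

@[simp]
theorem phi_zero : phi (0 : Fin r →₀ ℕ) = 1 := by
  have hgcd : vecGcd (0 : Fin r →₀ ℕ) = 0 := Finset.gcd_eq_zero_iff.mpr fun _ _ => rfl
  simp [phi, phiOne, hgcd]

theorem phiOne_coeff_zero (k : ℕ) : (phiOne k).coeff 0 = 1 := by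
  rcases Nat.lt_trichotomy k 1 with hk | rfl | hk
  · simp [phiOne, Nat.lt_one_iff.mp hk]
  · simp [phiOne]
  · rw [phiOne, if_neg hk.ne', Polynomial.cyclotomic_coeff_zero ℤ hk]

theorem constantCoeff_phi (d : Fin r →₀ ℕ) : constantCoeff (phi d) = 1 := by
  rcases eq_or_ne d 0 with rfl | hd
  · rw [phi_zero, map_one]
  obtain ⟨v, hv⟩ := exists_eq_vecGcd_smul_vec hd
  have hvec : (constantCoeff.toIntAlgHom : MvPolynomial (Fin r) ℤ →ₐ[ℤ] ℤ)
      (monomial v.vec 1) = 0 := by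
    simp [constantCoeff_monomial, v.vec_ne_zero]
  change (constantCoeff.toIntAlgHom : MvPolynomial (Fin r) ℤ →ₐ[ℤ] ℤ) (phi d) = 1
  rw [hv, v.phi_smul_vec, ← Polynomial.aeval_algHom_apply, hvec, Polynomial.aeval_def,
    Polynomial.eval₂_at_zero, phiOne_coeff_zero, map_one]

theorem phi_ne_zero (d : Fin r →₀ ℕ) : phi d ≠ 0 := fun h => by
  simpa [h] using constantCoeff_phi d

theorem prime_phi {d : Fin r →₀ ℕ} (hd : d ≠ 0) : Prime (phi d) := by
  obtain ⟨v, k, η, hk, rfl, hη⟩ := exists_primitiveVector hd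
  have hdvd := v.phi_dvd_iff_genericEval_eq_zero hk hη
  refine ⟨phi_ne_zero _, fun hu => one_ne_zero (α := AddMonoidAlgebra ℂ (Fin r → ℤ)) ?_,
    fun a b hab => ?_⟩
  · exact (map_one (v.genericEval η)).symm.trans ((hdvd 1).mp hu.dvd)
  · rw [hdvd, map_mul, mul_eq_zero] at hab
    rwa [hdvd, hdvd]

theorem phi_dvd_one_sub_monomial_iff {d : Fin r →₀ ℕ} (hd : d ≠ 0) (e : Fin r →₀ ℕ) :
    phi d ∣ 1 - monomial e 1 ↔ e ∈ AddSubmonoid.multiples d := by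
  obtain ⟨v, k, η, hk, rfl, hη⟩ := exists_primitiveVector hd
  rw [v.phi_dvd_iff_genericEval_eq_zero hk hη, map_sub, map_one, sub_eq_zero,
    v.genericEval_monomial, AddMonoidAlgebra.one_def, v.mem_multiples_smul_vec_iff, eq_comm,
    AddMonoidAlgebra.single_inj, ← (IsPrimitiveRoot.coe_units_iff.mp hη).zpow_eq_one_iff_dvd,
    ← Units.val_eq_one]
  simp

theorem one_sub_monomial_smul (d : Fin r →₀ ℕ) (n : ℕ) :
    (1 - monomial (n • d) 1 : MvPolynomial (Fin r) ℤ) =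
      Polynomial.aeval (monomial d (1 : ℤ)) (1 - Polynomial.X ^ n : Polynomial ℤ) := by
  simp [monomial_pow]

theorem phi_dvd_aeval_monomial_iff {d : Fin r →₀ ℕ} (hd : d ≠ 0) (q : Polynomial ℤ) :
    phi d ∣ Polynomial.aeval (monomial d (1 : ℤ)) q ↔ q.eval 1 = 0 := by
  obtain ⟨v, k, η, hk, rfl, hη⟩ := exists_primitiveVector hd
  have hcomp : Polynomial.aeval (monomial (k • v.vec) (1 : ℤ)) q =
      Polynomial.aeval (monomial v.vec (1 : ℤ)) (q.comp (Polynomial.X ^ k : Polynomial ℤ)) := by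
    simp [Polynomial.aeval_comp, monomial_pow]
  have hone : Polynomial.aeval (1 : ℂ) q = ((q.eval 1 : ℤ) : ℂ) := by
    simpa [Polynomial.coe_aeval_eq_eval] using Polynomial.aeval_algebraMap_apply ℂ (1 : ℤ) q
  rw [v.phi_dvd_iff_genericEval_eq_zero hk hη, hcomp, v.genericEval_aeval_monomial,
    AddMonoidAlgebra.single_eq_zero, Polynomial.aeval_comp, map_pow, Polynomial.aeval_X,
    hη.pow_eq_one, hone, Int.cast_eq_zero]

theorem one_sub_monomial_eq_phi_mul {d : Fin r →₀ ℕ} (hd : d ≠ 0) :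
    ∃ C : MvPolynomial (Fin r) ℤ, ¬ phi d ∣ C ∧ 1 - monomial d 1 = phi d * C := by
  obtain ⟨v, k, η, hk, rfl, hη⟩ := exists_primitiveVector hd
  obtain ⟨q, hq⟩ : phiOne k ∣ 1 - Polynomial.X ^ k :=
    (phiOne_dvd_iff hk hη _).mpr (by simp [hη.pow_eq_one])
  refine ⟨Polynomial.aeval (monomial v.vec (1 : ℤ)) q, fun hdvd => ?_, ?_⟩
  · have hqη : Polynomial.aeval (η : ℂ) q = 0 := by
      simpa [v.phi_dvd_iff_genericEval_eq_zero hk hη, v.genericEval_aeval_monomial] using hdvd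
    have hderiv := congrArg (fun p => Polynomial.aeval (η : ℂ) (Polynomial.derivative p)) hq
    simp [Polynomial.derivative_X_pow, Polynomial.derivative_mul, hqη, hk.ne',
      (phiOne_dvd_iff hk hη _).mp dvd_rfl] at hderiv
  · rw [v.phi_smul_vec, ← map_mul, ← hq, one_sub_monomial_smul]

theorem one_sub_monomial_smul_eq_phi_mul {d : Fin r →₀ ℕ} (hd : d ≠ 0) {n : ℕ} (hn : n ≠ 0) :
    ∃ C : MvPolynomial (Fin r) ℤ, ¬ phi d ∣ C ∧ 1 - monomial (n • d) 1 = phi d * C := by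
  obtain ⟨C, hC, h⟩ := one_sub_monomial_eq_phi_mul hd
  let q : Polynomial ℤ := ∑ i ∈ Finset.range n, Polynomial.X ^ i
  refine ⟨C * Polynomial.aeval (monomial d (1 : ℤ)) q, fun hdvd => ?_, ?_⟩
  · have hq : q.eval 1 ≠ 0 := by simp [q, Polynomial.eval_finsetSum, hn]
    exact ((prime_phi hd).dvd_or_dvd hdvd).elim hC
      fun h => hq ((phi_dvd_aeval_monomial_iff hd q).mp h)
  · rw [one_sub_monomial_smul, ← mul_neg_geom_sum, map_mul, ← mul_assoc, ← h]
    simp [q]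

theorem eq_of_phi_dvd_phi {d e : Fin r →₀ ℕ} (hd : d ≠ 0) (he : e ≠ 0) (h : phi d ∣ phi e) :
    d = e := by
  have mem_multiples {d e : Fin r →₀ ℕ} (hd : d ≠ 0) (he : e ≠ 0) (h : phi d ∣ phi e) :
      e ∈ AddSubmonoid.multiples d := by
    obtain ⟨C, -, hC⟩ := one_sub_monomial_eq_phi_mul he
    exact (phi_dvd_one_sub_monomial_iff hd e).mp (h.trans ⟨C, hC⟩)
  obtain ⟨n, hn⟩ := mem_multiples hd he h
  obtain ⟨m, hm⟩ := mem_multiples he hd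
    ((prime_phi hd).associated_of_dvd (prime_phi he) h).symm.dvd
  ext i
  exact Nat.dvd_antisymm (Dvd.intro_left n (DFunLike.congr_fun hn i))
    (Dvd.intro_left m (DFunLike.congr_fun hm i))

theorem prod_divisors_phiOne {k : ℕ} (hk : 0 < k) :
    ∏ j ∈ k.divisors, phiOne j = 1 - Polynomial.X ^ k := by
  have hone : 1 ∈ k.divisors := Nat.one_mem_divisors.mpr hk.ne'
  have hrest : ∏ j ∈ k.divisors.erase 1, phiOne j =
      ∏ j ∈ k.divisors.erase 1, Polynomial.cyclotomic j ℤ :=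
    Finset.prod_congr rfl fun j hj => if_neg (Finset.ne_of_mem_erase hj)
  rw [← neg_sub, ← Polynomial.prod_cyclotomic_eq_X_pow_sub_one hk ℤ,
    ← Finset.mul_prod_erase _ _ hone, ← Finset.mul_prod_erase _ _ hone, hrest, phiOne, if_pos rfl,
    Polynomial.cyclotomic_one, ← neg_mul, neg_sub]

theorem one_sub_monomial_eq_prod {e : Fin r →₀ ℕ} (he : e ≠ 0) :
    ∃ s : Finset (Fin r →₀ ℕ), 0 ∉ s ∧
      (1 - monomial e 1 : MvPolynomial (Fin r) ℤ) = ∏ d ∈ s, phi d := by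
  classical
  obtain ⟨v, k, -, hk, rfl, -⟩ := exists_primitiveVector he
  refine ⟨k.divisors.image fun j => j • v.vec, fun h0 => ?_, ?_⟩
  · obtain ⟨j, hj, hj0⟩ := Finset.mem_image.mp h0
    exact (Nat.pos_of_mem_divisors hj).ne' ((smul_eq_zero.mp hj0).resolve_right v.vec_ne_zero)
  · rw [Finset.prod_image fun i _ j _ hij => v.smul_vec_injective hij, one_sub_monomial_smul,
      ← prod_divisors_phiOne hk, map_prod]
    exact Finset.prod_congr rfl fun j _ => (v.phi_smul_vec j).symm

theorem phi_pow_dvd_prod_iff {d : Fin r →₀ ℕ} (hd : d ≠ 0) (m : (Fin r →₀ ℕ) →₀ ℕ) (k : ℕ) :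
    phi d ^ k ∣ m.prod (fun e a => phi e ^ a) ↔ k ≤ m d := by
  classical
  have hp := prime_phi hd
  have hndvd : ¬ phi d ∣ (m.erase d).prod fun e a => phi e ^ a := by
    rw [Finsupp.prod, hp.dvd_finsetProd_iff]
    rintro ⟨e, he, hdvd⟩
    have hde := hp.dvd_of_dvd_pow hdvd
    rw [Finsupp.support_erase] at he
    rcases eq_or_ne e 0 with rfl | he0
    · exact hp.not_isUnit (isUnit_of_dvd_one (phi_zero ▸ hde))
    · exact Finset.ne_of_mem_erase he (eq_of_phi_dvd_phi hd he0 hde).symm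
  rw [← Finsupp.mul_prod_erase' m d (fun e a => phi e ^ a) (fun _ => pow_zero _)]
  exact ⟨fun h => (pow_dvd_pow_iff hp.ne_zero hp.not_isUnit).mp
    (hp.pow_dvd_of_dvd_mul_right k hndvd h), fun h => (pow_dvd_pow _ h).mul_right _⟩

end Phi

section PoleOrder

variable {A B : Type*} [CommRing A] [CommRing B] [Algebra A B] {π : A} {m n : ℕ} {F F' : B}

/-- For a prime `π` of `A`, the order of the pole of `F` along `π = 0` is at most `n`. Here `A` is
a ring of polynomials inside the ring `B` of power series, and `⊥ : Subalgebra A B` consists of the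
series that are polynomials. -/
def PoleOrderLE (π : A) (n : ℕ) (F : B) : Prop :=
  ∃ a, ¬ π ∣ a ∧ (π ^ n * a) • F ∈ (⊥ : Subalgebra A B)

namespace PoleOrderLE

theorem of_mem_bot (hπ : Prime π) (hF : F ∈ (⊥ : Subalgebra A B)) : PoleOrderLE π n F :=
  ⟨1, fun h => hπ.not_isUnit (isUnit_of_dvd_one h), Subalgebra.smul_mem _ hF _⟩

theorem add (hπ : Prime π) (hF : PoleOrderLE π n F) (hF' : PoleOrderLE π n F') :
    PoleOrderLE π n (F + F') := by
  obtain ⟨a, ha, hF⟩ := hF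
  obtain ⟨a', ha', hF'⟩ := hF'
  refine ⟨a * a', fun h => (hπ.dvd_or_dvd h).elim ha ha', ?_⟩
  have hsplit : (π ^ n * (a * a')) • (F + F') =
      a' • (π ^ n * a) • F + a • (π ^ n * a') • F' := by
    simp only [smul_add, smul_smul]
    ring_nf
  rw [hsplit]
  exact add_mem (Subalgebra.smul_mem _ hF _) (Subalgebra.smul_mem _ hF' _)

theorem smul (hF : PoleOrderLE π n F) (a : A) : PoleOrderLE π n (a • F) := by
  obtain ⟨a', ha', hF⟩ := hF
  exact ⟨a', ha', by rw [smul_comm]; exact Subalgebra.smul_mem _ hF a⟩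

theorem of_smul (hπ : Prime π) {a : A} (ha : ¬ π ∣ a) (hF : PoleOrderLE π n (a • F)) :
    PoleOrderLE π n F := by
  obtain ⟨a', ha', hF⟩ := hF
  exact ⟨a' * a, fun h => (hπ.dvd_or_dvd h).elim ha' ha, by rwa [← mul_assoc, mul_smul]⟩

theorem of_self_smul (hF : PoleOrderLE π n (π • F)) : PoleOrderLE π (n + 1) F := by
  obtain ⟨a, ha, hF⟩ := hF
  exact ⟨a, ha, by rwa [pow_succ, mul_right_comm, mul_smul]⟩

end PoleOrderLE

section Domain

variable [IsDomain A] [NoZeroDivisors B] [FaithfulSMul A B]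

theorem poleOrderLE_iff_of_smul_eq (hπ : Prime π) {b c : ℕ} {u a : A} (hu : ¬ π ∣ u)
    (ha : ¬ π ∣ a) (h : (π ^ b * u) • F = algebraMap A B (π ^ c * a)) :
    PoleOrderLE π n F ↔ b ≤ n + c := by
  have hinj := FaithfulSMul.algebraMap_injective A B
  simp only [Algebra.smul_def] at h
  constructor
  · rintro ⟨a', ha', z, hz⟩
    rw [AlgHom.toRingHom_eq_coe, RingHom.coe_coe, Algebra.ofId_apply, Algebra.smul_def] at hz
    have hmul : π ^ b * (u * z) = π ^ (n + c) * (a' * a) := hinj <| by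
      rw [← mul_assoc, map_mul, hz, mul_left_comm, h, ← map_mul]
      ring_nf
    exact (pow_dvd_pow_iff hπ.ne_zero hπ.not_isUnit).mp <| hπ.pow_dvd_of_dvd_mul_right b
      (fun h => (hπ.dvd_or_dvd h).elim ha' ha) (Dvd.intro _ hmul)
  · intro hbc
    obtain ⟨k, hk⟩ := Nat.exists_eq_add_of_le hbc
    refine ⟨u, hu, π ^ k * a, ?_⟩
    have hc : algebraMap A B (π ^ c) ≠ 0 :=
      (map_ne_zero_iff _ hinj).mpr (pow_ne_zero _ hπ.ne_zero)
    refine mul_left_cancel₀ hc ?_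
    rw [AlgHom.toRingHom_eq_coe, RingHom.coe_coe, Algebra.ofId_apply, Algebra.smul_def]
    calc algebraMap A B (π ^ c) * algebraMap A B (π ^ k * a)
        = algebraMap A B (π ^ k) * (algebraMap A B (π ^ b * u) * F) := by
          rw [h, ← map_mul, ← map_mul, mul_left_comm]
      _ = algebraMap A B (π ^ (n + c)) * (algebraMap A B u * F) := by
          rw [hk, pow_add]
          simp only [map_mul]
          ring
      _ = algebraMap A B (π ^ c) * (algebraMap A B (π ^ n * u) * F) := by
          rw [pow_add]
          simp only [map_mul]
          ring

theorem PoleOrderLE.smul_mem_bot (hπ : Prime π) (hF : PoleOrderLE π n F) {b : ℕ} {u : A}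
    (hu : (π ^ b * u) • F ∈ (⊥ : Subalgebra A B)) :
    (π ^ n * u) • F ∈ (⊥ : Subalgebra A B) := by
  rcases le_total b n with hbn | hbn
  · obtain ⟨k, rfl⟩ := Nat.exists_eq_add_of_le hbn
    rw [pow_add, mul_right_comm, mul_comm, mul_smul]
    exact Subalgebra.smul_mem _ hu _
  obtain ⟨k, rfl⟩ := Nat.exists_eq_add_of_le hbn
  have hinj := FaithfulSMul.algebraMap_injective A B
  obtain ⟨a, ha, z, hz⟩ := hF
  obtain ⟨w, hw⟩ := hu
  simp only [AlgHom.toRingHom_eq_coe, RingHom.coe_coe, Algebra.ofId_apply,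
    Algebra.smul_def] at hz hw
  have hdvd : a * w = π ^ k * (z * u) := hinj <| by
    simp only [map_mul, map_pow] at hz hw ⊢
    rw [hz, hw]
    ring
  obtain ⟨w, rfl⟩ := hπ.pow_dvd_of_dvd_mul_left k ha ⟨_, hdvd⟩
  refine ⟨w, ?_⟩
  refine mul_left_cancel₀ (pow_ne_zero k ((map_ne_zero_iff _ hinj).mpr hπ.ne_zero)) ?_
  simp only [AlgHom.toRingHom_eq_coe, RingHom.coe_coe, Algebra.ofId_apply,
    Algebra.smul_def, map_mul, map_pow] at hw ⊢
  rw [hw]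
  ring

theorem prod_pow_smul_mem_bot {ι : Type*} {p : ι → A} {k : ι → ℕ} {s : Finset ι}
    (hp : ∀ i ∈ s, Prime (p i)) (hpole : ∀ i ∈ s, PoleOrderLE (p i) (k i) F) (b : ι → ℕ) {u : A}
    (hu : ((∏ i ∈ s, p i ^ b i) * u) • F ∈ (⊥ : Subalgebra A B)) :
    ((∏ i ∈ s, p i ^ k i) * u) • F ∈ (⊥ : Subalgebra A B) := by
  classical
  induction s using Finset.induction_on generalizing u with
  | empty => simpa using hu
  | insert i s hi ih =>
    rw [Finset.prod_insert hi, mul_assoc] at hu ⊢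
    have hmem := (hpole i (Finset.mem_insert_self i s)).smul_mem_bot
      (hp i (Finset.mem_insert_self i s)) hu
    rw [mul_left_comm] at hmem ⊢
    exact ih (fun j hj => hp j (Finset.mem_insert_of_mem hj))
      (fun j hj => hpole j (Finset.mem_insert_of_mem hj)) hmem

end Domain

end PoleOrder

section PowerSeries

theorem mvPowerSeries_algebraMap_eq_coe {σ R : Type*} [CommRing R] (p : MvPolynomial σ R) :
    algebraMap (MvPolynomial σ R) (MvPowerSeries σ R) p = p := by
  rw [MvPowerSeries.algebraMap_apply', Algebra.algebraMap_self, MvPowerSeries.map_id]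
  rfl

theorem powerSeries_algebraMap_eq_coe {R : Type*} [CommRing R] (p : Polynomial R) :
    algebraMap (Polynomial R) (PowerSeries R) p = p := by
  rw [PowerSeries.algebraMap_apply', Algebra.algebraMap_self, PowerSeries.map_id]
  rfl

instance {σ R : Type*} [CommRing R] : FaithfulSMul (MvPolynomial σ R) (MvPowerSeries σ R) :=
  (faithfulSMul_iff_algebraMap_injective _ _).mpr fun p q h => by
    simpa only [mvPowerSeries_algebraMap_eq_coe, MvPolynomial.coe_inj] using h

instance {R : Type*} [CommRing R] : FaithfulSMul (Polynomial R) (PowerSeries R) :=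
  (faithfulSMul_iff_algebraMap_injective _ _).mpr fun p q h => by
    simpa only [powerSeries_algebraMap_eq_coe, Polynomial.coe_inj] using h

theorem smul_mem_bot_iff {σ R : Type*} [CommRing R] {B : MvPolynomial σ R}
    {F : MvPowerSeries σ R} :
    B • F ∈ (⊥ : Subalgebra (MvPolynomial σ R) (MvPowerSeries σ R)) ↔
      ∃ A : MvPolynomial σ R, (B : MvPowerSeries σ R) * F = A := by
  simp only [Algebra.mem_bot, Set.mem_range, mvPowerSeries_algebraMap_eq_coe, Algebra.smul_def,
    eq_comm]

end PowerSeries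

section HilbertSeries

open MvPolynomial (monomial)

theorem finrank_map_add_finrank_ker_inf {K V W : Type*} [Field K] [AddCommGroup V] [Module K V]
    [AddCommGroup W] [Module K W] (f : V →ₗ[K] W) (p : Submodule K V) [Module.Finite K p] :
    Module.finrank K (p.map f) + Module.finrank K ↥(LinearMap.ker f ⊓ p) =
      Module.finrank K p := by
  have h := LinearMap.finrank_range_add_finrank_ker (f.domRestrict p)
  rw [LinearMap.range_domRestrict, LinearMap.ker_domRestrict] at h
  rw [← h, inf_comm, ← Submodule.map_comap_subtype, Submodule.finrank_map_subtype_eq]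

theorem finrank_sup_map_add_finrank_comap_inf {K V W : Type*} [Field K] [AddCommGroup V]
    [Module K V] [AddCommGroup W] [Module K W] (f : V →ₗ[K] W) (p : Submodule K V)
    (q : Submodule K W) [Module.Finite K p] [Module.Finite K q] :
    Module.finrank K ↥(q ⊔ p.map f) + Module.finrank K ↥(q.comap f ⊓ p) =
      Module.finrank K q + Module.finrank K p := by
  have hsup := finrank_map_add_finrank_ker_inf q.mkQ (q ⊔ p.map f)
  have hp := finrank_map_add_finrank_ker_inf (q.mkQ ∘ₗ f) p
  rw [LinearMap.ker_comp, Submodule.ker_mkQ, Submodule.map_comp] at hp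
  rw [Submodule.ker_mkQ, inf_eq_left.mpr le_sup_left, Submodule.map_sup, Submodule.mkQ_map_self,
    bot_sup_eq] at hsup
  omega

variable {K R : Type*} [Field K] [CommRing R] [Algebra K R] {r : ℕ}
  (𝓡 : (Fin r →₀ ℕ) → Submodule K R)

/-- The Hilbert series of the quotient `R ⧸ I`. -/
def quotSeries (I : Ideal R) : MvPowerSeries (Fin r) ℤ :=
  hilbertSeries 𝓡 ⊤ - hilbertSeries 𝓡 I

theorem coeff_hilbertSeries (I : Ideal R) (c : Fin r →₀ ℕ) :
    MvPowerSeries.coeff c (hilbertSeries 𝓡 I) =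
      Module.finrank K ↥(I.restrictScalars K ⊓ 𝓡 c) :=
  rfl

theorem coeff_quotSeries (I : Ideal R) (c : Fin r →₀ ℕ) :
    MvPowerSeries.coeff c (quotSeries 𝓡 I) =
      (Module.finrank K (𝓡 c) : ℤ) - Module.finrank K ↥(I.restrictScalars K ⊓ 𝓡 c) := by
  rw [quotSeries, map_sub, coeff_hilbertSeries, coeff_hilbertSeries, Submodule.restrictScalars_top,
    top_inf_eq]

theorem coeff_quotSeries_eq_zero {I : Ideal R} {c : Fin r →₀ ℕ}
    (h : 𝓡 c ≤ I.restrictScalars K) : MvPowerSeries.coeff c (quotSeries 𝓡 I) = 0 := by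
  rw [coeff_quotSeries, inf_eq_right.mpr h, sub_self]

theorem quotSeries_top : quotSeries 𝓡 ⊤ = 0 := sub_self _

theorem hilbertSeries_eq_quotSeries_bot_sub (I : Ideal R) :
    hilbertSeries 𝓡 I = quotSeries 𝓡 ⊥ - quotSeries 𝓡 I := by
  have hbot : hilbertSeries 𝓡 ⊥ = 0 := by
    ext c
    rw [coeff_hilbertSeries, Submodule.restrictScalars_bot, bot_inf_eq, finrank_bot]
    rfl
  rw [quotSeries, quotSeries, hbot]
  abel

theorem quotSeries_mem_bot_of_forall_le {I : Ideal R}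
    (h : ∀ e, e ≠ 0 → 𝓡 e ≤ I.restrictScalars K) :
    quotSeries 𝓡 I ∈ (⊥ : Subalgebra (MvPolynomial (Fin r) ℤ) (MvPowerSeries (Fin r) ℤ)) := by
  refine ⟨MvPolynomial.C (MvPowerSeries.coeff 0 (quotSeries 𝓡 I)), ?_⟩
  rw [AlgHom.toRingHom_eq_coe, RingHom.coe_coe, Algebra.ofId_apply,
    mvPowerSeries_algebraMap_eq_coe]
  ext c
  rw [MvPolynomial.coeff_coe, MvPolynomial.coeff_C]
  split_ifs with hc
  · rw [hc]
  · rw [coeff_quotSeries_eq_zero 𝓡 (h c (Ne.symm hc))]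

variable [GradedAlgebra 𝓡]

theorem finite_gradedPiece [IsNoetherianRing R] (h0 : 𝓡 0 = 1) (d : Fin r →₀ ℕ) :
    Module.Finite K (𝓡 d) := by
  classical
  obtain ⟨s, hs, hspan⟩ := (Submodule.fg_span_iff_fg_span_finset_subset (R := R)
    (𝓡 d : Set R)).mp (IsNoetherian.noetherian _)
  suffices h : 𝓡 d = Submodule.span K (s : Set R) from h ▸ Module.Finite.span_finset K s
  refine le_antisymm (fun f hf => ?_) (Submodule.span_le.mpr hs)
  have hf' : f ∈ Submodule.span R (s : Set R) := hspan ▸ Submodule.subset_span hf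
  obtain ⟨a, -, ha⟩ := Submodule.mem_span_finset.mp hf'
  rw [← DirectSum.decompose_of_mem_same 𝓡 hf, ← ha, DirectSum.decompose_sum,
    DFinsupp.finsetSum_apply, AddSubmonoidClass.coe_finsetSum]
  refine Submodule.sum_mem _ fun x hx => ?_
  obtain ⟨z, hz⟩ := Submodule.mem_one.mp (h0.le (DirectSum.decompose 𝓡 (a x) 0).2)
  have hax := DirectSum.coe_decompose_mul_of_right_mem_of_le 𝓡 (a := a x) (hs hx) le_rfl
  rw [tsub_self, ← hz, ← Algebra.smul_def] at hax
  rw [smul_eq_mul, hax]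
  exact Submodule.smul_mem _ _ (Submodule.subset_span hx)

variable {𝓡} {I : Ideal R} {e : Fin r →₀ ℕ} {x : R}

theorem isHomogeneous_colon_singleton (hI : I.IsHomogeneous 𝓡) (hx : x ∈ 𝓡 e) :
    Ideal.IsHomogeneous 𝓡 (I.colon {x}) := by
  intro i a ha
  have h := DirectSum.coe_decompose_mul_of_right_mem_of_le 𝓡 (a := a) hx
    (le_add_left le_rfl : e ≤ i + e)
  rw [add_tsub_cancel_right] at h
  rw [Submodule.mem_colon_singleton, smul_eq_mul] at ha ⊢
  rw [← h]
  exact hI _ ha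

theorem isHomogeneous_sup_span_singleton (hI : I.IsHomogeneous 𝓡) (hx : x ∈ 𝓡 e) :
    (I ⊔ Ideal.span {x}).IsHomogeneous 𝓡 :=
  hI.sup (Ideal.homogeneous_span 𝓡 _ fun _ hy => Set.mem_singleton_iff.mp hy ▸ ⟨e, hx⟩)

theorem sup_span_singleton_inf_gradedPiece_add (hI : I.IsHomogeneous 𝓡) (hx : x ∈ 𝓡 e)
    (c : Fin r →₀ ℕ) :
    (I ⊔ Ideal.span {x}).restrictScalars K ⊓ 𝓡 (c + e) =
      I.restrictScalars K ⊓ 𝓡 (c + e) ⊔ (𝓡 c).map (LinearMap.mulRight K x) := by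
  refine le_antisymm (fun z hz => ?_) (sup_le (inf_le_inf_right _ fun _ => Ideal.mem_sup_left) ?_)
  · obtain ⟨⟨i, hi, _, hw, rfl⟩, hzc⟩ := And.imp_left Submodule.mem_sup.mp hz
    obtain ⟨a, rfl⟩ := Ideal.mem_span_singleton'.mp hw
    have hcomp := DirectSum.decompose_of_mem_same 𝓡 hzc
    rw [DirectSum.decompose_add, DirectSum.add_apply, AddMemClass.coe_add,
      DirectSum.coe_decompose_mul_of_right_mem_of_le 𝓡 hx (le_add_left le_rfl),
      add_tsub_cancel_right] at hcomp
    rw [← hcomp]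
    exact Submodule.add_mem_sup ⟨hI _ hi, (DirectSum.decompose 𝓡 i (c + e)).2⟩
      ⟨_, (DirectSum.decompose 𝓡 a c).2, rfl⟩
  · rintro _ ⟨a, ha, rfl⟩
    exact ⟨Ideal.mem_sup_right (Ideal.mul_mem_left _ _ (Ideal.mem_span_singleton_self x)),
      SetLike.GradedMul.mul_mem ha hx⟩

theorem sup_span_singleton_inf_gradedPiece_of_not_le (hI : I.IsHomogeneous 𝓡) (hx : x ∈ 𝓡 e)
    {c : Fin r →₀ ℕ} (hec : ¬ e ≤ c) :
    (I ⊔ Ideal.span {x}).restrictScalars K ⊓ 𝓡 c = I.restrictScalars K ⊓ 𝓡 c := by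
  refine le_antisymm (fun z hz => ⟨?_, hz.2⟩) (inf_le_inf_right _ fun _ => Ideal.mem_sup_left)
  obtain ⟨⟨i, hi, _, hw, rfl⟩, hzc⟩ := And.imp_left Submodule.mem_sup.mp hz
  obtain ⟨a, rfl⟩ := Ideal.mem_span_singleton'.mp hw
  have hcomp := DirectSum.decompose_of_mem_same 𝓡 hzc
  rw [DirectSum.decompose_add, DirectSum.add_apply, AddMemClass.coe_add,
    DirectSum.coe_decompose_mul_of_right_mem_of_not_le 𝓡 hx hec, add_zero] at hcomp
  exact hcomp ▸ hI _ hi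

theorem homogeneous_induction [IsNoetherianRing R] {P : (I : Ideal R) → I.IsHomogeneous 𝓡 → Prop}
    (split : ∀ I hI e x (hx : x ∈ 𝓡 e), P (I ⊔ Ideal.span {x})
      (isHomogeneous_sup_span_singleton hI hx) →
      P (I.colon {x}) (isHomogeneous_colon_singleton hI hx) → P I hI)
    (prime : ∀ I hI, (∀ e x (hx : x ∈ 𝓡 e), x ∉ I → I.colon {x} = I ∧
      P (I ⊔ Ideal.span {x}) (isHomogeneous_sup_span_singleton hI hx)) → P I hI)
    (I : Ideal R) (hI : I.IsHomogeneous 𝓡) : P I hI := by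
  induction I using WellFoundedGT.induction with
  | ind I ih =>
    have hP_sup : ∀ e x (hx : x ∈ 𝓡 e), x ∉ I → P (I ⊔ Ideal.span {x})
        (isHomogeneous_sup_span_singleton hI hx) := fun e x hx hxI =>
      ih _ (left_lt_sup.mpr fun h => hxI (h (Ideal.mem_span_singleton_self x))) _
    by_cases h : ∀ e, ∀ x ∈ 𝓡 e, x ∉ I → I.colon {x} = I
    · exact prime I hI fun e x hx hxI => ⟨h e x hx hxI, hP_sup e x hx hxI⟩
    · push Not at h
      obtain ⟨e, x, hx, hxI, hcolon⟩ := h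
      exact split I hI e x hx (hP_sup e x hx hxI)
        (ih _ (Ideal.le_colon.lt_of_ne hcolon.symm) _)

variable [∀ e, Module.Finite K (𝓡 e)]

theorem quotSeries_eq_add (hI : I.IsHomogeneous 𝓡) (hx : x ∈ 𝓡 e) :
    quotSeries 𝓡 I = quotSeries 𝓡 (I ⊔ Ideal.span {x}) +
      (monomial e 1 : MvPolynomial (Fin r) ℤ) • quotSeries 𝓡 (I.colon {x}) := by
  ext c
  rw [map_add, Algebra.smul_def, mvPowerSeries_algebraMap_eq_coe, MvPolynomial.coe_monomial,
    MvPowerSeries.coeff_monomial_mul, one_mul]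
  split_ifs with hec
  · obtain ⟨c, rfl⟩ := exists_add_of_le hec
    have : Module.Finite K ↥(I.restrictScalars K ⊓ 𝓡 (c + e)) :=
      Submodule.finiteDimensional_of_le inf_le_right
    have hcomap : (I.restrictScalars K ⊓ 𝓡 (c + e)).comap (LinearMap.mulRight K x) ⊓ 𝓡 c =
        (I.colon {x}).restrictScalars K ⊓ 𝓡 c := by
      ext a
      simp only [Submodule.mem_inf, Submodule.mem_comap, LinearMap.mulRight_apply,
        Submodule.restrictScalars_mem, Submodule.mem_colon_singleton, smul_eq_mul]
      exact ⟨fun h => ⟨h.1.1, h.2⟩, fun h => ⟨⟨h.1, SetLike.GradedMul.mul_mem h.2 hx⟩, h.2⟩⟩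
    have hdim := finrank_sup_map_add_finrank_comap_inf (LinearMap.mulRight K x) (𝓡 c)
      (I.restrictScalars K ⊓ 𝓡 (c + e))
    rw [hcomap, ← sup_span_singleton_inf_gradedPiece_add hI hx] at hdim
    rw [add_tsub_cancel_left, add_comm e, coeff_quotSeries, coeff_quotSeries, coeff_quotSeries]
    lia
  · rw [add_zero, coeff_quotSeries, coeff_quotSeries,
      sup_span_singleton_inf_gradedPiece_of_not_le hI hx hec]

theorem one_sub_monomial_smul_quotSeries (hI : I.IsHomogeneous 𝓡) (hx : x ∈ 𝓡 e)
    (hcolon : I.colon {x} = I) :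
    (1 - monomial e 1 : MvPolynomial (Fin r) ℤ) • quotSeries 𝓡 I =
      quotSeries 𝓡 (I ⊔ Ideal.span {x}) := by
  have h := quotSeries_eq_add hI hx
  rw [hcolon] at h
  rw [sub_smul, one_smul, sub_eq_iff_eq_add]
  exact h

theorem exists_prod_one_sub_monomial_smul_quotSeries_mem_bot [IsNoetherianRing R]
    (hI : I.IsHomogeneous 𝓡) :
    ∃ l : Multiset (Fin r →₀ ℕ), (∀ e ∈ l, e ≠ 0 ∧ ¬ 𝓡 e ≤ I.restrictScalars K) ∧
      (l.map fun e => (1 - monomial e 1 : MvPolynomial (Fin r) ℤ)).prod • quotSeries 𝓡 I ∈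
        (⊥ : Subalgebra (MvPolynomial (Fin r) ℤ) (MvPowerSeries (Fin r) ℤ)) := by
  have mono {I J : Ideal R} (hIJ : I ≤ J) {e : Fin r →₀ ℕ}
      (he : e ≠ 0 ∧ ¬ 𝓡 e ≤ J.restrictScalars K) : e ≠ 0 ∧ ¬ 𝓡 e ≤ I.restrictScalars K :=
    ⟨he.1, fun h => he.2 (h.trans hIJ)⟩
  induction I, hI using homogeneous_induction with
  | split I hI e x hx hsup hcolon =>
    obtain ⟨l₁, hl₁, hmem₁⟩ := hsup
    obtain ⟨l₂, hl₂, hmem₂⟩ := hcolon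
    refine ⟨l₁ + l₂, fun e he => (Multiset.mem_add.mp he).elim (fun h => mono le_sup_left (hl₁ e h))
      fun h => mono Ideal.le_colon (hl₂ e h), ?_⟩
    rw [quotSeries_eq_add hI hx, smul_add, Multiset.map_add, Multiset.prod_add, mul_smul, smul_comm,
      mul_smul, smul_comm _ (monomial e 1 : MvPolynomial (Fin r) ℤ)]
    exact add_mem (Subalgebra.smul_mem _ hmem₁ _)
      (Subalgebra.smul_mem _ (Subalgebra.smul_mem _ hmem₂ _) _)
  | prime I hI ih =>
    by_cases h : ∀ e, e ≠ 0 → 𝓡 e ≤ I.restrictScalars K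
    · exact ⟨0, by simp, by simpa using quotSeries_mem_bot_of_forall_le 𝓡 h⟩
    push Not at h
    obtain ⟨e, he, hle⟩ := h
    obtain ⟨x, hx, hxI⟩ := SetLike.not_le_iff_exists.mp hle
    obtain ⟨hcolon, l, hl, hmem⟩ := ih e x hx hxI
    refine ⟨e ::ₘ l, Multiset.forall_mem_cons.mpr
      ⟨⟨he, hle⟩, fun e he => mono le_sup_left (hl e he)⟩, ?_⟩
    rwa [Multiset.map_cons, Multiset.prod_cons, mul_comm, mul_smul,
      one_sub_monomial_smul_quotSeries hI hx hcolon]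

end HilbertSeries

section OffLine

theorem ringKrullDim_quotient_antitone {R : Type*} [CommRing R] :
    Antitone fun I : Ideal R => ringKrullDim (R ⧸ I) := fun _ _ h =>
  ringKrullDim_le_of_surjective (Ideal.Quotient.factor h) (Ideal.Quotient.factor_surjective h)

theorem ringKrullDim_quotient_sup_span_singleton_add_one_le {R : Type*} [CommRing R] {I : Ideal R}
    {x : R} (hcolon : I.colon {x} = I) :
    ringKrullDim (R ⧸ (I ⊔ Ideal.span {x})) + 1 ≤ ringKrullDim (R ⧸ I) := by
  refine ringKrullDim_succ_le_of_surjective (Ideal.Quotient.factor le_sup_left)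
    (Ideal.Quotient.factor_surjective le_sup_left) (r := Ideal.Quotient.mk I x) ?_ ?_
  · rw [mem_nonZeroDivisors_iff_right]
    intro z hz
    obtain ⟨a, rfl⟩ := Ideal.Quotient.mk_surjective z
    rw [← map_mul, Ideal.Quotient.eq_zero_iff_mem] at hz
    exact Ideal.Quotient.eq_zero_iff_mem.mpr (hcolon.le (Submodule.mem_colon_singleton.mpr hz))
  · rw [Ideal.Quotient.factor_mk, Ideal.Quotient.eq_zero_iff_mem]
    exact Ideal.mem_sup_right (Ideal.mem_span_singleton_self x)

theorem eq_top_or_exists_ringKrullDim_quotient_le {R : Type*} [CommRing R] {I : Ideal R} {n : ℕ}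
    (h : ringKrullDim (R ⧸ I) + 1 ≤ n) :
    I = ⊤ ∨ ∃ m, n = m + 1 ∧ ringKrullDim (R ⧸ I) ≤ m := by
  rw [or_iff_not_imp_left]
  intro hI
  have := Ideal.Quotient.nontrivial_iff.mpr hI
  cases n with
  | zero =>
    have hone : (1 : WithBot ℕ∞) ≤ 0 :=
      (le_add_of_nonneg_left ringKrullDim_nonneg_of_nontrivial).trans (by exact_mod_cast h)
    norm_num at hone
  | succ m =>
    push_cast at h
    exact ⟨m, rfl, ENat.WithBot.add_le_add_one_right_iff.mp h⟩

theorem PoleOrderLE.of_one_sub_monomial_smul_smul {r : ℕ} {d : Fin r →₀ ℕ} (hd : d ≠ 0) {k : ℕ}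
    (hk : k ≠ 0) {n : ℕ} {F : MvPowerSeries (Fin r) ℤ}
    (h : PoleOrderLE (phi d) n
      ((1 - MvPolynomial.monomial (k • d) 1 : MvPolynomial (Fin r) ℤ) • F)) :
    PoleOrderLE (phi d) (n + 1) F := by
  obtain ⟨u, hu, hfactor⟩ := one_sub_monomial_smul_eq_phi_mul hd hk
  rw [hfactor, mul_comm, mul_smul] at h
  exact (h.of_smul (prime_phi hd) hu).of_self_smul

variable {K R : Type*} [Field K] [CommRing R] [Algebra K R] {r : ℕ}
  (𝓡 : (Fin r →₀ ℕ) → Submodule K R)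

/-- The ideal generated by the homogeneous elements whose degree is not a multiple of `d`. The
dimension of its zero locus is the exponent of `φ_d` in the universal denominator. -/
def offLine (d : Fin r →₀ ℕ) : Ideal R :=
  Ideal.span {f | ∃ e ∉ AddSubmonoid.multiples d, f ∈ 𝓡 e}

variable {𝓡} {d : Fin r →₀ ℕ} {I : Ideal R}

theorem offLine_le_iff :
    offLine 𝓡 d ≤ I ↔ ∀ e ∉ AddSubmonoid.multiples d, 𝓡 e ≤ I.restrictScalars K :=
  Ideal.span_le.trans ⟨fun h e he _ hf => h ⟨e, he, hf⟩, fun h _ ⟨e, he, hf⟩ => h e he hf⟩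

variable [GradedAlgebra 𝓡]

theorem isHomogeneous_offLine : (offLine 𝓡 d).IsHomogeneous 𝓡 :=
  Ideal.homogeneous_span 𝓡 _ fun _ ⟨e, _, hf⟩ => ⟨e, hf⟩

variable [∀ e, Module.Finite K (𝓡 e)]

theorem poleOrderLE_quotSeries_of_colon_eq {n : ℕ} (hd : d ≠ 0) (hI : I.IsHomogeneous 𝓡)
    (hoff : offLine 𝓡 d ≤ I) {e : Fin r →₀ ℕ} (he : e ≠ 0) {x : R} (hx : x ∈ 𝓡 e) (hxI : x ∉ I)
    (hcolon : I.colon {x} = I) (hn : ringKrullDim (R ⧸ I) ≤ n)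
    (ih : ∀ m : ℕ, ringKrullDim (R ⧸ (I ⊔ Ideal.span {x})) ≤ m →
      PoleOrderLE (phi d) m (quotSeries 𝓡 (I ⊔ Ideal.span {x}))) :
    PoleOrderLE (phi d) n (quotSeries 𝓡 I) := by
  obtain ⟨k, rfl⟩ : e ∈ AddSubmonoid.multiples d := by_contra fun he =>
    hxI (offLine_le_iff.mp hoff e he hx)
  have hk : k ≠ 0 := fun hk => he (by simp only [hk, zero_smul])
  have hsmul := one_sub_monomial_smul_quotSeries hI hx hcolon
  rcases eq_top_or_exists_ringKrullDim_quotient_le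
    ((ringKrullDim_quotient_sup_span_singleton_add_one_le hcolon).trans hn) with htop | ⟨m, rfl, hm⟩
  · rw [htop, quotSeries_top, Algebra.smul_def, mul_eq_zero, map_eq_zero_iff _
      (FaithfulSMul.algebraMap_injective _ _), sub_eq_zero, MvPolynomial.one_def,
      MvPolynomial.monomial_left_inj one_ne_zero] at hsmul
    rw [hsmul.resolve_left he.symm]
    exact .of_mem_bot (prime_phi hd) (zero_mem _)
  · exact .of_one_sub_monomial_smul_smul hd hk (hsmul ▸ ih m hm)

theorem poleOrderLE_quotSeries [IsNoetherianRing R] (hd : d ≠ 0) (hI : I.IsHomogeneous 𝓡) {n : ℕ}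
    (hn : ringKrullDim (R ⧸ (I ⊔ offLine 𝓡 d)) ≤ n) : PoleOrderLE (phi d) n (quotSeries 𝓡 I) := by
  have hprime := prime_phi hd
  induction I, hI using homogeneous_induction generalizing n with
  | split I hI e x hx hsup hcolon =>
    rw [quotSeries_eq_add hI hx]
    exact (hsup <| (ringKrullDim_quotient_antitone (sup_le_sup_right le_sup_left _)).trans hn).add
      hprime ((hcolon <| (ringKrullDim_quotient_antitone
        (sup_le_sup_right Ideal.le_colon _)).trans hn).smul _)
  | prime I hI ih =>
    by_cases hirr : ∀ e, e ≠ 0 → 𝓡 e ≤ I.restrictScalars K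
    · exact .of_mem_bot hprime (quotSeries_mem_bot_of_forall_le 𝓡 hirr)
    by_cases hoff : offLine 𝓡 d ≤ I
    · push Not at hirr
      obtain ⟨e, he, hle⟩ := hirr
      obtain ⟨x, hx, hxI⟩ := SetLike.not_le_iff_exists.mp hle
      rw [sup_eq_left.mpr hoff] at hn
      refine poleOrderLE_quotSeries_of_colon_eq hd hI hoff he hx hxI (ih e x hx hxI).1 hn
        fun m hm => (ih e x hx hxI).2 ?_
      rwa [sup_eq_left.mpr (hoff.trans le_sup_left)]
    · rw [offLine_le_iff] at hoff
      push Not at hoff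
      obtain ⟨e, he, hle⟩ := hoff
      obtain ⟨x, hx, hxI⟩ := SetLike.not_le_iff_exists.mp hle
      have hsup := (ih e x hx hxI).2
        ((ringKrullDim_quotient_antitone (sup_le_sup_right le_sup_left _)).trans hn)
      rw [← one_sub_monomial_smul_quotSeries hI hx (ih e x hx hxI).1] at hsup
      exact hsup.of_smul hprime fun hdvd => he ((phi_dvd_one_sub_monomial_iff hd e).mp hdvd)

end OffLine

section RealValues

open Filter Topology

/-- Absolute convergence of an integral power series at the real number `u`. -/
def SummableAt (u : ℝ) (f : PowerSeries ℤ) : Prop :=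
  Summable fun k => ‖((PowerSeries.coeff k f : ℤ) : ℝ) * u ^ k‖

/-- The value of an integral power series at the real number `u`; it is meaningful where the series
converges absolutely. -/
def seriesValue (u : ℝ) (f : PowerSeries ℤ) : ℝ :=
  ∑' k, ((PowerSeries.coeff k f : ℤ) : ℝ) * u ^ k

variable {u : ℝ} {f g h : PowerSeries ℤ}

theorem coeff_mul_mul_pow (u : ℝ) (f g : PowerSeries ℤ) (n : ℕ) :
    ((PowerSeries.coeff n (f * g) : ℤ) : ℝ) * u ^ n =
      ∑ x ∈ Finset.HasAntidiagonal.antidiagonal n, (((PowerSeries.coeff x.1 f : ℤ) : ℝ) * u ^ x.1) *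
        (((PowerSeries.coeff x.2 g : ℤ) : ℝ) * u ^ x.2) := by
  rw [PowerSeries.coeff_mul, Int.cast_sum, Finset.sum_mul]
  refine Finset.sum_congr rfl fun x hx => ?_
  rw [← Finset.HasAntidiagonal.mem_antidiagonal.mp hx, pow_add, Int.cast_mul, mul_mul_mul_comm]

theorem SummableAt.mul (hf : SummableAt u f) (hg : SummableAt u g) : SummableAt u (f * g) := by
  simp only [SummableAt, coeff_mul_mul_pow]
  exact summable_norm_sum_mul_antidiagonal_of_summable_norm
    (f := fun k => ((PowerSeries.coeff k f : ℤ) : ℝ) * u ^ k)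
    (g := fun k => ((PowerSeries.coeff k g : ℤ) : ℝ) * u ^ k) hf hg

theorem seriesValue_mul (hf : SummableAt u f) (hg : SummableAt u g) :
    seriesValue u (f * g) = seriesValue u f * seriesValue u g := by
  simp only [seriesValue, coeff_mul_mul_pow]
  exact (tsum_mul_tsum_eq_tsum_sum_antidiagonal_of_summable_norm hf hg).symm

theorem seriesValue_mono (hu : 0 ≤ u) (hf : SummableAt u f) (hg : SummableAt u g)
    (hle : ∀ k, PowerSeries.coeff k f ≤ PowerSeries.coeff k g) :
    seriesValue u f ≤ seriesValue u g :=
  hf.of_norm.tsum_le_tsum (fun k => by have := hle k; gcongr) hg.of_norm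

theorem coeff_coe_mul_pow_eq_zero (u : ℝ) {p : Polynomial ℤ} {k : ℕ} (hk : k ∉ p.support) :
    ((PowerSeries.coeff k (p : PowerSeries ℤ) : ℤ) : ℝ) * u ^ k = 0 := by
  rw [Polynomial.coeff_coe, Polynomial.notMem_support_iff.mp hk, Int.cast_zero, zero_mul]

theorem summableAt_coe (u : ℝ) (p : Polynomial ℤ) : SummableAt u (p : PowerSeries ℤ) :=
  summable_of_ne_finset_zero (s := p.support) fun k hk => by
    rw [coeff_coe_mul_pow_eq_zero u hk, norm_zero]

theorem seriesValue_coe (u : ℝ) (p : Polynomial ℤ) :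
    seriesValue u (p : PowerSeries ℤ) = Polynomial.aeval u p := by
  rw [seriesValue, tsum_eq_sum fun k hk => coeff_coe_mul_pow_eq_zero u hk, Polynomial.aeval_def,
    Polynomial.eval₂_eq_sum, Polynomial.sum]
  simp only [Polynomial.coeff_coe, algebraMap_int_eq, eq_intCast]

theorem seriesValue_smul (hf : SummableAt u f) (p : Polynomial ℤ) :
    seriesValue u (p • f) = Polynomial.aeval u p * seriesValue u f := by
  rw [Algebra.smul_def, powerSeries_algebraMap_eq_coe, seriesValue_mul (summableAt_coe u p) hf,
    seriesValue_coe]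

/-- The power series `1 / (1 - X^k)`, for `k ≠ 0`. -/
def geomSeries (k : ℕ) : PowerSeries ℤ := PowerSeries.mk fun n => if k ∣ n then 1 else 0

theorem one_sub_X_pow_mul_geomSeries {k : ℕ} (hk : k ≠ 0) :
    (1 - PowerSeries.X ^ k) * geomSeries k = 1 := by
  rw [sub_mul, one_mul]
  ext n
  rw [map_sub, PowerSeries.coeff_X_pow_mul', PowerSeries.coeff_one, geomSeries,
    PowerSeries.coeff_mk]
  by_cases hkn : k ≤ n
  · obtain ⟨j, rfl⟩ := Nat.exists_eq_add_of_le hkn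
    rw [if_pos hkn, PowerSeries.coeff_mk, if_neg (by lia : k + j ≠ 0), Nat.add_sub_cancel_left]
    simp only [Nat.dvd_add_right (dvd_refl k), sub_self]
  · have hdvd : k ∣ n ↔ n = 0 :=
      ⟨fun h => by_contra fun hn => hkn (Nat.le_of_dvd (Nat.pos_of_ne_zero hn) h),
        fun h => h ▸ dvd_zero k⟩
    rw [if_neg hkn, sub_zero]
    simp only [hdvd]

theorem summableAt_geomSeries (hu0 : 0 ≤ u) (hu1 : u < 1) (k : ℕ) :
    SummableAt u (geomSeries k) := by
  refine Summable.of_nonneg_of_le (fun _ => norm_nonneg _) (fun n => ?_)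
    (summable_geometric_of_lt_one hu0 hu1)
  rw [geomSeries, PowerSeries.coeff_mk, norm_mul, Real.norm_of_nonneg (pow_nonneg hu0 n)]
  split_ifs
  · simp
  · simp [pow_nonneg hu0 n]

variable {l : Multiset ℕ}

theorem prod_one_sub_X_pow_smul_prod_geomSeries (hl : 0 ∉ l) :
    (l.map fun k => (1 - Polynomial.X ^ k : Polynomial ℤ)).prod • (l.map geomSeries).prod = 1 := by
  rw [Algebra.smul_def, map_multiset_prod, Multiset.map_map, ← Multiset.prod_map_mul]
  refine Multiset.prod_eq_one fun f hf => ?_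
  obtain ⟨k, hk, rfl⟩ := Multiset.mem_map.mp hf
  rw [Function.comp_apply, powerSeries_algebraMap_eq_coe, Polynomial.coe_sub, Polynomial.coe_one,
    Polynomial.coe_pow, Polynomial.coe_X]
  exact one_sub_X_pow_mul_geomSeries (ne_of_mem_of_not_mem hk hl)

theorem summableAt_prod_geomSeries (hu0 : 0 ≤ u) (hu1 : u < 1) :
    SummableAt u (l.map geomSeries).prod :=
  Multiset.prod_induction _ _ (fun _ _ => SummableAt.mul)
    (by simpa only [Polynomial.coe_one] using summableAt_coe u 1) fun f hf => by
      obtain ⟨k, -, rfl⟩ := Multiset.mem_map.mp hf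
      exact summableAt_geomSeries hu0 hu1 k

theorem prod_one_sub_pow_mul_seriesValue_prod_geomSeries (hu0 : 0 ≤ u) (hu1 : u < 1)
    (hl : 0 ∉ l) :
    (l.map fun k => 1 - u ^ k).prod * seriesValue u (l.map geomSeries).prod = 1 := by
  have hval := seriesValue_smul (summableAt_prod_geomSeries (l := l) hu0 hu1)
    (l.map fun k => 1 - Polynomial.X ^ k).prod
  rw [prod_one_sub_X_pow_smul_prod_geomSeries hl, ← Polynomial.coe_one, seriesValue_coe, map_one,
    map_multiset_prod, Multiset.map_map] at hval
  simpa only [Function.comp_def, map_sub, map_one, map_pow, Polynomial.aeval_X] using hval.symm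

theorem summableAt_of_prod_smul_mem_bot (hu0 : 0 ≤ u) (hu1 : u < 1) (hl : 0 ∉ l)
    (hh : (l.map fun k => (1 - Polynomial.X ^ k : Polynomial ℤ)).prod • h ∈
      (⊥ : Subalgebra (Polynomial ℤ) (PowerSeries ℤ))) : SummableAt u h := by
  obtain ⟨a, ha⟩ := hh
  rw [AlgHom.toRingHom_eq_coe, RingHom.coe_coe, Algebra.ofId_apply,
    powerSeries_algebraMap_eq_coe] at ha
  have heq : h = (l.map geomSeries).prod * a := by
    rw [ha, mul_smul_comm, ← smul_mul_assoc, prod_one_sub_X_pow_smul_prod_geomSeries hl, one_mul]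
  exact heq ▸ (summableAt_prod_geomSeries hu0 hu1).mul (summableAt_coe u a)

theorem one_sub_pow_le_mul (hu0 : 0 ≤ u) (k : ℕ) : 1 - u ^ k ≤ (1 - u) * k := by
  have := one_add_mul_le_pow (a := u - 1) (by linarith) k
  rw [add_sub_cancel] at this
  linarith

theorem prod_one_sub_pow_le (hu0 : 0 ≤ u) (hu1 : u ≤ 1) :
    (l.map fun k => 1 - u ^ k).prod ≤ (1 - u) ^ l.card * (l.prod : ℕ) := by
  have hcard : (1 - u) ^ l.card * (l.prod : ℕ) = (l.map fun k : ℕ => (1 - u) * (k : ℝ)).prod := by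
    rw [Multiset.prod_map_mul, Multiset.map_const', Multiset.prod_replicate, Nat.cast_multiset_prod]
  rw [hcard]
  exact Multiset.prod_map_le_prod_map₀ _ _ (fun k _ => sub_nonneg.mpr (pow_le_one₀ hu0 hu1))
    fun k _ => one_sub_pow_le_mul hu0 k

theorem one_le_pow_card_mul_seriesValue (hu0 : 0 ≤ u) (hu1 : u < 1) (hl : 0 ∉ l)
    (hh : SummableAt u h)
    (hle : ∀ k, PowerSeries.coeff k (l.map geomSeries).prod ≤ PowerSeries.coeff k h) :
    1 ≤ (l.prod : ℕ) * ((1 - u) ^ l.card * seriesValue u h) := by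
  have hG := summableAt_prod_geomSeries (l := l) hu0 hu1
  have hprod := prod_one_sub_pow_mul_seriesValue_prod_geomSeries hu0 hu1 hl
  have hprod0 : 0 ≤ (l.map fun k => 1 - u ^ k).prod := by
    refine Multiset.prod_nonneg fun x hx => ?_
    obtain ⟨k, -, rfl⟩ := Multiset.mem_map.mp hx
    exact sub_nonneg.mpr (pow_le_one₀ hu0 hu1.le)
  have hG0 : 0 ≤ seriesValue u (l.map geomSeries).prod :=
    (pos_of_mul_pos_right (by rw [hprod]; exact one_pos) hprod0).le
  have hGh := seriesValue_mono hu0 hG hh hle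
  calc 1 = (l.map fun k => 1 - u ^ k).prod * seriesValue u (l.map geomSeries).prod := hprod.symm
    _ ≤ (l.map fun k => 1 - u ^ k).prod * seriesValue u h := by gcongr
    _ ≤ (1 - u) ^ l.card * (l.prod : ℕ) * seriesValue u h :=
      mul_le_mul_of_nonneg_right (prod_one_sub_pow_le hu0 hu1.le) (hG0.trans hGh)
    _ = (l.prod : ℕ) * ((1 - u) ^ l.card * seriesValue u h) := by ring

theorem X_sub_one_dvd_iff (p : Polynomial ℤ) : Polynomial.X - 1 ∣ p ↔ p.eval 1 = 0 := by
  rw [← map_one Polynomial.C, Polynomial.dvd_iff_isRoot, Polynomial.IsRoot]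

theorem tendsto_one_sub_pow_mul_seriesValue {m n : ℕ}
    (hh : ∀ u ∈ Set.Ioo (0 : ℝ) 1, SummableAt u h)
    (hpole : PoleOrderLE (Polynomial.X - 1 : Polynomial ℤ) n h) (hnm : n < m) :
    Tendsto (fun u => (1 - u) ^ m * seriesValue u h) (𝓝[<] 1) (𝓝 0) := by
  obtain ⟨B, hB, A, hA⟩ := hpole
  rw [AlgHom.toRingHom_eq_coe, RingHom.coe_coe, Algebra.ofId_apply,
    powerSeries_algebraMap_eq_coe] at hA
  have hB1 : Polynomial.aeval (1 : ℝ) B ≠ 0 := by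
    rw [X_sub_one_dvd_iff] at hB
    rw [← map_one (algebraMap ℤ ℝ), Polynomial.aeval_algebraMap_apply, Polynomial.coe_aeval_eq_eval]
    simpa using hB
  have hlim : Tendsto (fun u : ℝ => (-1) ^ n * (1 - u) ^ (m - n) *
      (Polynomial.aeval u A / Polynomial.aeval u B)) (𝓝[<] 1) (𝓝 0) := by
    have hcont : ContinuousAt (fun u : ℝ => (-1) ^ n * (1 - u) ^ (m - n) *
        (Polynomial.aeval u A / Polynomial.aeval u B)) 1 :=
      (by fun_prop : ContinuousAt (fun u : ℝ => (-1) ^ n * (1 - u) ^ (m - n)) 1).mul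
        (A.continuous_aeval.continuousAt.div B.continuous_aeval.continuousAt hB1)
    have hzero : (1 - 1 : ℝ) ^ (m - n) = 0 := by
      rw [sub_self, zero_pow (Nat.sub_ne_zero_of_lt hnm)]
    simpa only [hzero, mul_zero, zero_mul] using hcont.tendsto.mono_left nhdsWithin_le_nhds
  refine hlim.congr' ?_
  filter_upwards [Ioo_mem_nhdsLT one_pos, nhdsWithin_le_nhds
    (B.continuous_aeval.continuousAt.eventually_ne hB1)] with u hu hBu
  have hval := seriesValue_smul (hh u hu) ((Polynomial.X - 1) ^ n * B)
  rw [← hA, seriesValue_coe, map_mul, map_pow, map_sub, map_one, Polynomial.aeval_X] at hval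
  have hsign : ((-1 : ℝ) ^ n) * (u - 1) ^ n = (1 - u) ^ n := by
    rw [← mul_pow, neg_one_mul, neg_sub]
  rw [hval, mul_assoc ((u - 1) ^ n), mul_div_assoc, mul_div_cancel_left₀ _ hBu,
    ← Nat.add_sub_of_le hnm.le, pow_add, Nat.add_sub_cancel_left, ← hsign]
  ring

theorem card_le_of_prod_geomSeries_le {n : ℕ} (hl : 0 ∉ l)
    (hh : ∀ u ∈ Set.Ioo (0 : ℝ) 1, SummableAt u h)
    (hle : ∀ k, PowerSeries.coeff k (l.map geomSeries).prod ≤ PowerSeries.coeff k h)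
    (hpole : PoleOrderLE (Polynomial.X - 1 : Polynomial ℤ) n h) : l.card ≤ n := by
  by_contra! hlt
  have hlim := (tendsto_one_sub_pow_mul_seriesValue hh hpole hlt).const_mul ((l.prod : ℕ) : ℝ)
  have hle0 := ge_of_tendsto hlim <| by
    filter_upwards [Ioo_mem_nhdsLT one_pos] with u hu
    exact one_le_pow_card_mul_seriesValue hu.1.le hu.2 hl (hh u hu) hle
  rw [mul_zero] at hle0
  exact absurd hle0 (by norm_num)

end RealValues

section RestrictLine

open MvPolynomial (monomial)

variable {r : ℕ} {d : Fin r →₀ ℕ}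

/-- The coefficients of a power series at the multiples `k • d` of `d`, collected into a power
series in the single variable `t^d`. -/
def restrictLine (d : Fin r →₀ ℕ) : MvPowerSeries (Fin r) ℤ →+ PowerSeries ℤ where
  toFun F := PowerSeries.mk fun k => MvPowerSeries.coeff (k • d) F
  map_zero' := by
    ext
    rw [PowerSeries.coeff_mk, map_zero, map_zero]
  map_add' F G := by
    ext
    rw [map_add, PowerSeries.coeff_mk, PowerSeries.coeff_mk, PowerSeries.coeff_mk, map_add]

theorem coeff_restrictLine (k : ℕ) (F : MvPowerSeries (Fin r) ℤ) :
    PowerSeries.coeff k (restrictLine d F) = MvPowerSeries.coeff (k • d) F :=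
  PowerSeries.coeff_mk k fun k => MvPowerSeries.coeff (k • d) F

theorem coeff_monomial_smul (e c : Fin r →₀ ℕ) (a : ℤ) (F : MvPowerSeries (Fin r) ℤ) :
    MvPowerSeries.coeff c (monomial e a • F) =
      if e ≤ c then a * MvPowerSeries.coeff (c - e) F else 0 := by
  rw [Algebra.smul_def, mvPowerSeries_algebraMap_eq_coe, MvPolynomial.coe_monomial,
    MvPowerSeries.coeff_monomial_mul]

theorem aeval_monomial_monomial (d : Fin r →₀ ℕ) (j : ℕ) (a : ℤ) :
    Polynomial.aeval (monomial d (1 : ℤ)) (Polynomial.monomial j a) = monomial (j • d) a := by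
  rw [Polynomial.aeval_monomial, MvPolynomial.monomial_pow, one_pow, MvPolynomial.algebraMap_eq,
    MvPolynomial.C_mul_monomial, mul_one]

theorem restrictLine_aeval_smul (hd : d ≠ 0) (q : Polynomial ℤ) (F : MvPowerSeries (Fin r) ℤ) :
    restrictLine d (Polynomial.aeval (monomial d (1 : ℤ)) q • F) = q • restrictLine d F := by
  induction q using Polynomial.induction_on' with
  | add p q hp hq => rw [map_add, add_smul, map_add, hp, hq, add_smul]
  | monomial j a =>
    ext k
    have hle : j • d ≤ k • d ↔ j ≤ k := by
      refine ⟨fun h => ?_, fun h => nsmul_le_nsmul_left zero_le h⟩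
      obtain ⟨i, hi⟩ := DFunLike.ne_iff.mp hd
      exact Nat.le_of_mul_le_mul_right (h i) (Nat.pos_of_ne_zero hi)
    rw [aeval_monomial_monomial, coeff_restrictLine, coeff_monomial_smul, Algebra.smul_def,
      powerSeries_algebraMap_eq_coe, ← Polynomial.C_mul_X_pow_eq_monomial, Polynomial.coe_mul,
      Polynomial.coe_C, Polynomial.coe_pow, Polynomial.coe_X, mul_assoc, PowerSeries.coeff_C_mul,
      PowerSeries.coeff_X_pow_mul']
    simp only [hle]
    split_ifs with hjk
    · obtain ⟨i, rfl⟩ := Nat.exists_eq_add_of_le hjk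
      rw [add_smul, add_tsub_cancel_left, Nat.add_sub_cancel_left, coeff_restrictLine]
    · rw [mul_zero]

theorem restrictLine_algebraMap_aeval (hd : d ≠ 0) (q : Polynomial ℤ) :
    restrictLine d (algebraMap (MvPolynomial (Fin r) ℤ) _
      (Polynomial.aeval (monomial d (1 : ℤ)) q)) = algebraMap _ _ q := by
  have hone : restrictLine d (1 : MvPowerSeries (Fin r) ℤ) = 1 := by
    ext k
    rw [coeff_restrictLine, MvPowerSeries.coeff_one, PowerSeries.coeff_one]
    simp only [smul_eq_zero, hd, or_false]
  rw [Algebra.algebraMap_eq_smul_one, restrictLine_aeval_smul hd, hone,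
    Algebra.algebraMap_eq_smul_one]

theorem exists_eq_aeval_monomial {A : MvPolynomial (Fin r) ℤ}
    (hA : ∀ c ∉ AddSubmonoid.multiples d, A.coeff c = 0) :
    ∃ a : Polynomial ℤ, A = Polynomial.aeval (monomial d (1 : ℤ)) a := by
  suffices h : A ∈ (Polynomial.aeval (R := ℤ) (monomial d (1 : ℤ))).range from
    h.imp fun _ => Eq.symm
  rw [A.as_sum]
  refine Subalgebra.sum_mem _ fun c hc => ?_
  obtain ⟨n, rfl⟩ : c ∈ AddSubmonoid.multiples d :=
    by_contra fun hne => MvPolynomial.mem_support_iff.mp hc (hA c hne)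
  exact ⟨Polynomial.monomial n _, aeval_monomial_monomial d n _⟩

variable {F : MvPowerSeries (Fin r) ℤ}

theorem coeff_aeval_smul_eq_zero
    (hF : ∀ c ∉ AddSubmonoid.multiples d, MvPowerSeries.coeff c F = 0) (q : Polynomial ℤ)
    {c : Fin r →₀ ℕ} (hc : c ∉ AddSubmonoid.multiples d) :
    MvPowerSeries.coeff c (Polynomial.aeval (monomial d (1 : ℤ)) q • F) = 0 := by
  induction q using Polynomial.induction_on' with
  | add p q hp hq => rw [map_add, add_smul, map_add, hp, hq, add_zero]
  | monomial j a =>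
    rw [aeval_monomial_monomial, coeff_monomial_smul]
    split_ifs with hjc
    · rw [hF, mul_zero]
      refine fun hmem => hc ?_
      rw [← tsub_add_cancel_of_le hjc]
      exact add_mem hmem (AddSubmonoid.nsmul_mem _ (AddSubmonoid.mem_multiples d) j)
    · rfl

theorem exists_smul_eq_algebraMap_aeval
    (hF : ∀ c ∉ AddSubmonoid.multiples d, MvPowerSeries.coeff c F = 0) {q : Polynomial ℤ}
    (hq : Polynomial.aeval (monomial d (1 : ℤ)) q • F ∈
      (⊥ : Subalgebra (MvPolynomial (Fin r) ℤ) (MvPowerSeries (Fin r) ℤ))) :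
    ∃ a : Polynomial ℤ, Polynomial.aeval (monomial d (1 : ℤ)) q • F =
      algebraMap (MvPolynomial (Fin r) ℤ) _ (Polynomial.aeval (monomial d (1 : ℤ)) a) := by
  obtain ⟨A, hA⟩ := hq
  rw [AlgHom.toRingHom_eq_coe, RingHom.coe_coe, Algebra.ofId_apply] at hA
  obtain ⟨a, rfl⟩ : ∃ a : Polynomial ℤ, A = Polynomial.aeval (monomial d (1 : ℤ)) a := by
    refine exists_eq_aeval_monomial fun c hc => ?_
    rw [← MvPolynomial.coeff_coe, ← mvPowerSeries_algebraMap_eq_coe, hA,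
      coeff_aeval_smul_eq_zero hF q hc]
  exact ⟨a, hA.symm⟩

theorem smul_restrictLine_mem_bot (hd : d ≠ 0)
    (hF : ∀ c ∉ AddSubmonoid.multiples d, MvPowerSeries.coeff c F = 0) {q : Polynomial ℤ}
    (hq : Polynomial.aeval (monomial d (1 : ℤ)) q • F ∈
      (⊥ : Subalgebra (MvPolynomial (Fin r) ℤ) (MvPowerSeries (Fin r) ℤ))) :
    q • restrictLine d F ∈ (⊥ : Subalgebra (Polynomial ℤ) (PowerSeries ℤ)) := by
  obtain ⟨a, ha⟩ := exists_smul_eq_algebraMap_aeval hF hq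
  rw [← restrictLine_aeval_smul hd, ha, restrictLine_algebraMap_aeval hd]
  exact Subalgebra.algebraMap_mem _ a

theorem exists_eq_X_sub_one_pow_mul {p : Polynomial ℤ} (hp : p ≠ 0) :
    ∃ (b : ℕ) (q : Polynomial ℤ), p = (Polynomial.X - 1) ^ b * q ∧ ¬ Polynomial.X - 1 ∣ q := by
  obtain ⟨q, hq, hndvd⟩ := Polynomial.exists_eq_pow_rootMultiplicity_mul_and_not_dvd p hp 1
  exact ⟨_, q, hq, hndvd⟩

theorem exists_aeval_X_sub_one_pow_mul (hd : d ≠ 0) (b : ℕ) {q : Polynomial ℤ}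
    (hq : ¬ Polynomial.X - 1 ∣ q) :
    ∃ u : MvPolynomial (Fin r) ℤ, ¬ phi d ∣ u ∧
      Polynomial.aeval (monomial d (1 : ℤ)) ((Polynomial.X - 1) ^ b * q) = phi d ^ b * u := by
  obtain ⟨D, hD, hfactor⟩ := one_sub_monomial_eq_phi_mul hd
  refine ⟨(-D) ^ b * Polynomial.aeval (monomial d (1 : ℤ)) q, fun h => ?_, ?_⟩
  · rcases (prime_phi hd).dvd_or_dvd h with h | h
    · exact hD (dvd_neg.mp ((prime_phi hd).dvd_of_dvd_pow h))
    · exact hq ((X_sub_one_dvd_iff q).mpr ((phi_dvd_aeval_monomial_iff hd q).mp h))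
  · rw [map_mul, map_pow, map_sub, Polynomial.aeval_X, map_one (Polynomial.aeval _),
      ← neg_sub, hfactor, ← mul_neg,
      mul_pow, mul_assoc]

theorem PoleOrderLE.restrictLine (hd : d ≠ 0) {n : ℕ}
    (hF : ∀ c ∉ AddSubmonoid.multiples d, MvPowerSeries.coeff c F = 0) {q : Polynomial ℤ}
    (hq0 : q ≠ 0) (hq : Polynomial.aeval (monomial d (1 : ℤ)) q • F ∈
      (⊥ : Subalgebra (MvPolynomial (Fin r) ℤ) (MvPowerSeries (Fin r) ℤ)))
    (hpole : PoleOrderLE (phi d) n F) :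
    PoleOrderLE (Polynomial.X - 1 : Polynomial ℤ) n (UDenom.restrictLine d F) := by
  have hprime : Prime (Polynomial.X - 1 : Polynomial ℤ) := by
    simpa only [map_one] using Polynomial.prime_X_sub_C (1 : ℤ)
  obtain ⟨a, ha⟩ := exists_smul_eq_algebraMap_aeval hF hq
  have hline : q • UDenom.restrictLine d F = algebraMap _ _ a := by
    rw [← restrictLine_aeval_smul hd, ha, restrictLine_algebraMap_aeval hd]
  rcases eq_or_ne a 0 with rfl | ha0
  · rw [map_zero, Algebra.smul_def, mul_eq_zero,
      map_eq_zero_iff _ (FaithfulSMul.algebraMap_injective _ _)] at hline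
    exact .of_mem_bot hprime ((hline.resolve_left hq0) ▸ zero_mem _)
  obtain ⟨b, B, rfl, hB⟩ := exists_eq_X_sub_one_pow_mul hq0
  obtain ⟨c, A, rfl, hA⟩ := exists_eq_X_sub_one_pow_mul ha0
  obtain ⟨u, hu, hbu⟩ := exists_aeval_X_sub_one_pow_mul hd b hB
  obtain ⟨w, hw, hcw⟩ := exists_aeval_X_sub_one_pow_mul hd c hA
  rw [hbu, hcw] at ha
  exact (poleOrderLE_iff_of_smul_eq hprime hB hA hline).mpr
    ((poleOrderLE_iff_of_smul_eq (prime_phi hd) hu hw ha).mp hpole)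

end RestrictLine

section KrullDim

theorem ringKrullDim_quotient_le_of_forall_prime {R : Type*} [CommRing R] {J : Ideal R}
    {n : WithBot ℕ∞} (h : ∀ P : Ideal R, P.IsPrime → J ≤ P → ringKrullDim (R ⧸ P) ≤ n) :
    ringKrullDim (R ⧸ J) ≤ n := by
  rw [ringKrullDim_quotient, Order.krullDim]
  refine iSup_le fun p => le_trans ?_ (h p.head.1.asIdeal p.head.1.isPrime p.head.2)
  rw [ringKrullDim_quotient]
  let q : LTSeries (PrimeSpectrum.zeroLocus (p.head.1.asIdeal : Set R)) :=
    { length := p.length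
      toFun := fun i => ⟨(p i).1, LTSeries.head_le p i⟩
      step := fun i => p.step i }
  exact Order.LTSeries.length_le_krullDim q

theorem ringKrullDim_le_of_isIntegral (R S : Type*) [CommRing R] [CommRing S] [Algebra R S]
    [Algebra.IsIntegral R S] : ringKrullDim S ≤ ringKrullDim R :=
  Order.krullDim_le_of_strictMono (fun P : PrimeSpectrum S => P.comap (algebraMap R S))
    fun P Q hPQ => Ideal.IsIntegral.comap_lt_comap (R := R) (I := P.asIdeal) (J := Q.asIdeal) hPQ

theorem ringKrullDim_eq_of_isIntegral (R S : Type*) [CommRing R] [CommRing S] [Algebra R S]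
    [Algebra.IsIntegral R S] (hinj : Function.Injective (algebraMap R S)) :
    ringKrullDim S = ringKrullDim R := by
  refine le_antisymm (ringKrullDim_le_of_isIntegral R S) (iSup_le fun l => ?_)
  have hker : RingHom.ker (algebraMap R S) ≤ l.head.asIdeal :=
    ((RingHom.injective_iff_ker_eq_bot _).mp hinj).trans_le bot_le
  obtain ⟨Q, -, hQ, hQc⟩ := Ideal.exists_ideal_over_prime_of_isIntegral (S := S)
    l.head.asIdeal ⊥ hker
  have : Q.LiesOver l.head.asIdeal := ⟨hQc.symm⟩
  obtain ⟨L, hL, -⟩ := Ideal.exists_ltSeries_of_hasGoingUp (S := S) l Q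
  rw [← hL]
  exact Order.LTSeries.length_le_krullDim L

theorem exists_ringKrullDim_eq_and_algebraicIndependent (K A : Type*) [Field K] [CommRing A]
    [Nontrivial A] [Algebra K A] [Algebra.FiniteType K A] :
    ∃ (s : ℕ) (x : Fin s → A), ringKrullDim A = s ∧ AlgebraicIndependent K x := by
  obtain ⟨s, g, hinj, hint⟩ := exists_integral_inj_algHom_of_fg K A
  refine ⟨s, fun i => g (MvPolynomial.X i), ?_, ?_⟩
  · algebraize [g.toRingHom]
    rw [ringKrullDim_eq_of_isIntegral (MvPolynomial (Fin s) K) A hinj,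
      MvPolynomial.ringKrullDim_of_isNoetherianRing, ringKrullDim_eq_zero_of_field, zero_add,
      Nat.card_fin]
  · rw [AlgebraicIndependent]
    convert hinj
    exact (MvPolynomial.aeval_unique g).symm

end KrullDim

section AlgebraicIndependence

theorem exists_algebraicIndependent_mem_of_adjoin_eq_top {K A : Type*} [Field K] [CommRing A]
    [IsDomain A] [Algebra K A] {t : Set A} (ht : Algebra.adjoin K t = ⊤) {s : ℕ} {x : Fin s → A}
    (hx : AlgebraicIndependent K x) :
    ∃ y : Fin s → A, (∀ i, y i ∈ t) ∧ AlgebraicIndependent K y := by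
  have : Algebra.IsAlgebraic (Algebra.adjoin K t) A :=
    ⟨fun z => isAlgebraic_algebraMap (⟨z, ht ▸ Algebra.mem_top⟩ : Algebra.adjoin K t)⟩
  obtain ⟨b, hbt, hb⟩ := exists_isTranscendenceBasis_subset (R := K) t
  have hcard := hx.lift_cardinalMk_le_trdeg
  rw [← hb.cardinalMk_eq_trdeg] at hcard
  obtain ⟨φ⟩ := Cardinal.lift_mk_le'.mp hcard
  exact ⟨fun i => φ i, fun i => hbt (φ i).2, hb.1.comp φ φ.injective⟩

theorem card_le_finrank_of_algebraicIndependent {K A ι : Type*} [Field K] [CommRing A]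
    [Algebra K A] {x : ι → A} (hx : AlgebraicIndependent K x) {W : Submodule K A}
    [Module.Finite K W] {T : Finset (ι →₀ ℕ)}
    (hT : ∀ a ∈ T, a.prod (fun i n => x i ^ n) ∈ W) : T.card ≤ Module.finrank K W := by
  have hmonomials : LinearIndependent K fun a : ι →₀ ℕ => a.prod fun i n => x i ^ n := by
    simpa only [Function.comp_def, MvPolynomial.coe_basisMonomials, AlgHom.toLinearMap_apply,
      MvPolynomial.aeval_monomial, map_one, one_mul] using
      (MvPolynomial.basisMonomials ι K).linearIndependent.map' (MvPolynomial.aeval x).toLinearMap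
        (LinearMap.ker_eq_bot.mpr hx)
  have hW : LinearIndependent K fun a : T => (⟨_, hT a a.2⟩ : W) :=
    LinearIndependent.of_comp W.subtype (hmonomials.comp _ Subtype.val_injective)
  simpa only [Fintype.card_coe] using hW.fintype_card_le_finrank

theorem exists_finset_coeff_prod_geomSeries {ι : Type*} [Fintype ι] (N : ι → ℕ) (k : ℕ) :
    ∃ T : Finset (ι →₀ ℕ), PowerSeries.coeff k (∏ i, geomSeries (N i)) = T.card ∧
      ∀ a ∈ T, ∑ i, a i * N i = k := by
  classical
  let T := ((Finset.univ : Finset ι).finsuppAntidiag k).filter fun l => ∀ i, N i ∣ l i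
  let quotient (l : ι →₀ ℕ) : ι →₀ ℕ := Finsupp.equivFunOnFinite.symm fun i => l i / N i
  have hmul {l} (hl : l ∈ T) (i : ι) : quotient l i * N i = l i :=
    Nat.div_mul_cancel ((Finset.mem_filter.mp hl).2 i)
  have hinj : Set.InjOn quotient T := fun l hl l' hl' h => Finsupp.ext fun i => by
    rw [← hmul hl, ← hmul hl', h]
  refine ⟨T.image quotient, ?_, fun a ha => ?_⟩
  · rw [Finset.card_image_of_injOn hinj, PowerSeries.coeff_prod]
    simp only [geomSeries, PowerSeries.coeff_mk, Finset.prod_boole, Finset.mem_univ, true_imp_iff]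
    rw [Finset.sum_boole]
  · obtain ⟨l, hl, rfl⟩ := Finset.mem_image.mp ha
    simp only [hmul hl]
    exact (Finset.mem_finsuppAntidiag.mp (Finset.mem_filter.mp hl).1).1

end AlgebraicIndependence

section LowerBound

variable {K R : Type*} [Field K] [CommRing R] [Algebra K R] {r : ℕ}
  {𝓡 : (Fin r →₀ ℕ) → Submodule K R}

theorem coeff_quotSeries_offLine {d c : Fin r →₀ ℕ} (hc : c ∉ AddSubmonoid.multiples d) :
    MvPowerSeries.coeff c (quotSeries 𝓡 (offLine 𝓡 d)) = 0 :=
  coeff_quotSeries_eq_zero 𝓡 (offLine_le_iff.mp le_rfl c hc)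

theorem finrank_map_mk_le_coeff_quotSeries {J P : Ideal R} (hJP : J ≤ P) (c : Fin r →₀ ℕ)
    [Module.Finite K (𝓡 c)] :
    (Module.finrank K ((𝓡 c).map (Ideal.Quotient.mkₐ K P).toLinearMap) : ℤ) ≤
      MvPowerSeries.coeff c (quotSeries 𝓡 J) := by
  have : Module.Finite K ↥(P.restrictScalars K ⊓ 𝓡 c) :=
    Submodule.finiteDimensional_of_le inf_le_right
  have hmono : Module.finrank K ↥(J.restrictScalars K ⊓ 𝓡 c) ≤
      Module.finrank K ↥(P.restrictScalars K ⊓ 𝓡 c) :=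
    Submodule.finrank_mono (inf_le_inf_right _ hJP)
  have hrank := finrank_map_add_finrank_ker_inf (Ideal.Quotient.mkₐ K P).toLinearMap (𝓡 c)
  have hker : LinearMap.ker (Ideal.Quotient.mkₐ K P).toLinearMap = P.restrictScalars K := by
    ext x
    exact Ideal.Quotient.eq_zero_iff_mem
  rw [hker] at hrank
  rw [coeff_quotSeries]
  lia

variable [GradedAlgebra 𝓡]

theorem adjoin_mk_image_homogeneous (P : Ideal R) :
    Algebra.adjoin K (Ideal.Quotient.mk P '' {x | ∃ e, x ∈ 𝓡 e}) = ⊤ := by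
  rw [eq_top_iff]
  rintro z -
  obtain ⟨x, rfl⟩ := Ideal.Quotient.mk_surjective z
  induction x using DirectSum.Decomposition.inductionOn 𝓡 with
  | zero => exact map_zero (Ideal.Quotient.mk P) ▸ zero_mem _
  | @homogeneous e m => exact Algebra.subset_adjoin ⟨m, ⟨e, m.2⟩, rfl⟩
  | add a b ha hb =>
    rw [map_add]
    exact add_mem ha hb

variable (𝓡) in
theorem exists_homogeneous_algebraicIndependent [Algebra.FiniteType K R] (P : Ideal R)
    [P.IsPrime] :
    ∃ (s : ℕ) (y : Fin s → R), ringKrullDim (R ⧸ P) ≤ s ∧ (∀ i, ∃ e, y i ∈ 𝓡 e) ∧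
      AlgebraicIndependent K fun i => Ideal.Quotient.mk P (y i) := by
  obtain ⟨s, x, hdim, hx⟩ := exists_ringKrullDim_eq_and_algebraicIndependent K (R ⧸ P)
  obtain ⟨z, hz, hindep⟩ := exists_algebraicIndependent_mem_of_adjoin_eq_top
    (adjoin_mk_image_homogeneous (𝓡 := 𝓡) P) hx
  choose y hy hyz using hz
  exact ⟨s, y, hdim.le, hy, by simpa only [hyz] using hindep⟩

theorem coeff_prod_geomSeries_le {d : Fin r →₀ ℕ} {J P : Ideal R} (hJP : J ≤ P) {ι : Type*}
    [Fintype ι] {y : ι → R} {N : ι → ℕ} (hy : ∀ i, y i ∈ 𝓡 (N i • d))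
    (hindep : AlgebraicIndependent K fun i => Ideal.Quotient.mk P (y i)) (k : ℕ)
    [Module.Finite K (𝓡 (k • d))] :
    PowerSeries.coeff k (∏ i, geomSeries (N i)) ≤
      MvPowerSeries.coeff (k • d) (quotSeries 𝓡 J) := by
  obtain ⟨T, hcoeff, hT⟩ := exists_finset_coeff_prod_geomSeries N k
  rw [hcoeff]
  refine le_trans ?_ (finrank_map_mk_le_coeff_quotSeries hJP (k • d))
  refine Nat.cast_le.mpr (card_le_finrank_of_algebraicIndependent hindep fun a ha => ?_)
  refine ⟨∏ i, y i ^ a i, ?_, ?_⟩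
  · rw [← hT a ha, Finset.sum_smul]
    refine SetLike.prod_mem_graded 𝓡 _ _ fun i _ => ?_
    rw [mul_smul]
    exact SetLike.pow_mem_graded _ (hy i)
  · rw [Finsupp.prod_fintype _ _ fun i => pow_zero _]
    simp only [AlgHom.toLinearMap_apply, map_prod, map_pow, Ideal.Quotient.mkₐ_eq_mk]

theorem isAlgebraic_of_mem_gradedPiece_zero [Module.Finite K (𝓡 0)] {x : R} (hx : x ∈ 𝓡 0) :
    IsAlgebraic K x :=
  (IsIntegral.of_mem_of_fg (SetLike.GradeZero.subalgebra 𝓡)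
    (Module.Finite.iff_fg.mp ‹Module.Finite K (𝓡 0)›) x hx).isAlgebraic

theorem exists_pos_degree_on_line [Module.Finite K (𝓡 0)] {d : Fin r →₀ ℕ} {P : Ideal R}
    (hP : offLine 𝓡 d ≤ P) {x : R} (hx : ∃ e, x ∈ 𝓡 e)
    (htrans : Transcendental K (Ideal.Quotient.mk P x)) : ∃ N, N ≠ 0 ∧ x ∈ 𝓡 (N • d) := by
  obtain ⟨e, hx⟩ := hx
  obtain ⟨N, rfl⟩ : e ∈ AddSubmonoid.multiples d := by
    refine by_contra fun he => htrans ?_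
    rw [Ideal.Quotient.eq_zero_iff_mem.mpr (offLine_le_iff.mp hP e he hx)]
    exact isAlgebraic_zero
  refine ⟨N, ?_, hx⟩
  rintro rfl
  simp only [zero_smul] at hx
  exact htrans ((isAlgebraic_of_mem_gradedPiece_zero hx).algHom (Ideal.Quotient.mkₐ K P))

variable [∀ e, Module.Finite K (𝓡 e)]

variable (𝓡) in
theorem exists_prod_one_sub_X_pow_smul_quotSeries_offLine_mem_bot [IsNoetherianRing R]
    (d : Fin r →₀ ℕ) :
    ∃ l : Multiset ℕ, 0 ∉ l ∧ Polynomial.aeval (MvPolynomial.monomial d (1 : ℤ))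
      (l.map fun k => (1 - Polynomial.X ^ k : Polynomial ℤ)).prod • quotSeries 𝓡 (offLine 𝓡 d) ∈
        (⊥ : Subalgebra (MvPolynomial (Fin r) ℤ) (MvPowerSeries (Fin r) ℤ)) := by
  obtain ⟨l, hl, hmem⟩ := exists_prod_one_sub_monomial_smul_quotSeries_mem_bot
    (isHomogeneous_offLine (𝓡 := 𝓡) (d := d))
  have hline : ∀ e ∈ l, ∃ k : ℕ, k • d = e := fun e he =>
    by_contra fun hne => (hl e he).2 (offLine_le_iff.mp le_rfl e hne)
  choose! κ hκ using hline
  refine ⟨l.map κ, fun h0 => ?_, ?_⟩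
  · obtain ⟨e, he, hκe⟩ := Multiset.mem_map.mp h0
    exact (hl e he).1 (by rw [← hκ e he, hκe, zero_smul])
  · rw [map_multiset_prod, Multiset.map_map, Multiset.map_map]
    convert hmem using 3
    exact Multiset.map_congr rfl fun e he => by
      rw [Function.comp_apply, Function.comp_apply, ← one_sub_monomial_smul, hκ e he]

theorem ringKrullDim_quotient_offLine_le [Algebra.FiniteType K R] {d : Fin r →₀ ℕ} (hd : d ≠ 0)
    {n : ℕ} (hpole : PoleOrderLE (phi d) n (quotSeries 𝓡 (offLine 𝓡 d))) :
    ringKrullDim (R ⧸ offLine 𝓡 d) ≤ n := by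
  have : IsNoetherianRing R := Algebra.FiniteType.isNoetherianRing K R
  refine ringKrullDim_quotient_le_of_forall_prime fun P hP hJP => ?_
  obtain ⟨s, y, hdim, hhom, hindep⟩ := exists_homogeneous_algebraicIndependent 𝓡 P
  choose N hN hy using fun i => exists_pos_degree_on_line hJP (hhom i) (hindep.transcendental i)
  obtain ⟨l, hl, hmem⟩ := exists_prod_one_sub_X_pow_smul_quotSeries_offLine_mem_bot 𝓡 d
  have hl0 : (l.map fun k => (1 - Polynomial.X ^ k : Polynomial ℤ)).prod ≠ 0 :=
    left_ne_zero_of_smul (prod_one_sub_X_pow_smul_prod_geomSeries hl ▸ one_ne_zero)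
  have hcard : (Finset.univ.val.map N).card ≤ n := by
    refine card_le_of_prod_geomSeries_le (h := restrictLine d (quotSeries 𝓡 (offLine 𝓡 d)))
      (fun h0 => ?_) (fun u hu => summableAt_of_prod_smul_mem_bot hu.1.le hu.2 hl ?_)
      (fun k => ?_) (hpole.restrictLine hd (fun c => coeff_quotSeries_offLine) hl0 hmem)
    · obtain ⟨i, -, hi⟩ := Multiset.mem_map.mp h0
      exact hN i hi
    · exact smul_restrictLine_mem_bot hd (fun c => coeff_quotSeries_offLine) hmem
    · rw [Multiset.map_map, coeff_restrictLine]
      exact coeff_prod_geomSeries_le hJP hy hindep k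
  rw [Multiset.card_map, Finset.card_val, Finset.card_univ, Fintype.card_fin] at hcard
  exact hdim.trans (by exact_mod_cast hcard)

end LowerBound

section DimensionOnLines

variable {K R : Type*} [Field K] [CommRing R] [Algebra K R] {r : ℕ}
  (𝓡 : (Fin r →₀ ℕ) → Submodule K R)

theorem exists_finset_forall_le_offLine [IsNoetherianRing R] :
    ∃ s : Finset (Fin r →₀ ℕ), ∀ d ∉ s, ∀ e, e ≠ 0 → 𝓡 e ≤ (offLine 𝓡 d).restrictScalars K := by
  classical
  obtain ⟨t, ht, hspan⟩ := (Submodule.fg_span_iff_fg_span_finset_subset (R := R)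
    {f | ∃ e, e ≠ 0 ∧ f ∈ 𝓡 e}).mp (IsNoetherian.noetherian _)
  have hdegree (f) (hf : f ∈ t) : ∃ e, e ≠ 0 ∧ f ∈ 𝓡 e := ht hf
  choose! E hE0 hE using hdegree
  refine ⟨t.biUnion fun f => Finset.Iic (E f), fun d hd e he f hf => ?_⟩
  have hft : f ∈ Submodule.span R (t : Set R) := hspan ▸ Submodule.subset_span ⟨e, he, hf⟩
  refine (Submodule.span_le (p := offLine 𝓡 d)).mpr (fun g hg => ?_) hft
  refine Ideal.subset_span ⟨E g, ?_, hE g hg⟩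
  rintro ⟨n, hn⟩
  have hn0 : n ≠ 0 := by
    rintro rfl
    exact hE0 g hg (hn.symm.trans (zero_smul ℕ d))
  refine hd (Finset.mem_biUnion.mpr ⟨g, hg, Finset.mem_Iic.mpr ?_⟩)
  exact (le_self_nsmul zero_le hn0).trans_eq hn

variable [GradedAlgebra 𝓡]

theorem offLine_ne_top [Nontrivial R] (d : Fin r →₀ ℕ) : offLine 𝓡 d ≠ ⊤ := by
  refine ne_top_of_le_ne_top (RingHom.ker_ne_top (GradedRing.projZeroRingHom 𝓡)) ?_
  refine Ideal.span_le.mpr fun f ⟨e, he, hf⟩ => ?_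
  rw [SetLike.mem_coe, RingHom.mem_ker, GradedRing.projZeroRingHom_apply]
  exact DirectSum.decompose_of_mem_ne 𝓡 hf fun h => he (h ▸ zero_mem _)

theorem ringKrullDim_quotient_le_zero [Module.Finite K (𝓡 0)] {J : Ideal R}
    (hJ : ∀ e, e ≠ 0 → 𝓡 e ≤ J.restrictScalars K) : ringKrullDim (R ⧸ J) ≤ 0 := by
  have hsurj : Function.Surjective ((Ideal.Quotient.mkₐ K J).toLinearMap ∘ₗ (𝓡 0).subtype) := by
    intro y
    obtain ⟨x, rfl⟩ := Ideal.Quotient.mk_surjective y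
    induction x using DirectSum.Decomposition.inductionOn 𝓡 with
    | zero => exact ⟨0, map_zero _⟩
    | @homogeneous e x =>
      rcases eq_or_ne e 0 with rfl | he
      · exact ⟨x, rfl⟩
      · exact ⟨0, (map_zero _).trans (Ideal.Quotient.eq_zero_iff_mem.mpr (hJ e he x.2)).symm⟩
    | add x y hx hy =>
      obtain ⟨a, ha⟩ := hx
      obtain ⟨b, hb⟩ := hy
      exact ⟨a + b, by rw [map_add, ha, hb, map_add]⟩
  have := Module.Finite.of_surjective _ hsurj
  exact (ringKrullDim_le_of_isIntegral K (R ⧸ J)).trans_eq (ringKrullDim_eq_zero_of_field K)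

theorem exists_finsupp_eq_ringKrullDim_offLine [Nontrivial R] [Algebra.FiniteType K R]
    [Module.Finite K (𝓡 0)] : ∃ m : (Fin r →₀ ℕ) →₀ ℕ, m 0 = 0 ∧
      ∀ d, (m d : WithBot ℕ∞) = ringKrullDim (R ⧸ offLine 𝓡 d) := by
  have := Algebra.FiniteType.isNoetherianRing K R
  have hdim (d) : ∃ n : ℕ, ringKrullDim (R ⧸ offLine 𝓡 d) = n := by
    have := Ideal.Quotient.nontrivial_iff.mpr (offLine_ne_top 𝓡 d)
    obtain ⟨n, -, hn, -⟩ := exists_ringKrullDim_eq_and_algebraicIndependent K (R ⧸ offLine 𝓡 d)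
    exact ⟨n, hn⟩
  choose m hm using hdim
  have eq_zero {d} (h : ∀ e, e ≠ 0 → 𝓡 e ≤ (offLine 𝓡 d).restrictScalars K) : m d = 0 := by
    simpa [hm] using ringKrullDim_quotient_le_zero 𝓡 h
  obtain ⟨s, hs⟩ := exists_finset_forall_le_offLine 𝓡
  refine ⟨Finsupp.onFinset s m fun d hd => by_contra fun hds => hd (eq_zero (hs d hds)),
    eq_zero fun e he => offLine_le_iff.mp le_rfl e ?_, fun d => (hm d).symm⟩
  rintro ⟨n, rfl⟩
  exact he (smul_zero n)

end DimensionOnLines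

section UniversalDenominator

open MvPolynomial

variable {K R : Type*} [Field K] [CommRing R] [Algebra K R] {r : ℕ}
  {𝓡 : (Fin r →₀ ℕ) → Submodule K R} [GradedAlgebra 𝓡]

theorem IsUDenom.apply_eq {m m' : (Fin r →₀ ℕ) →₀ ℕ}
    (hm : IsUDenom 𝓡 (m.prod fun d a => phi d ^ a))
    (hm' : IsUDenom 𝓡 (m'.prod fun d a => phi d ^ a)) {d : Fin r →₀ ℕ} (hd : d ≠ 0) :
    m d = m' d := by
  apply le_antisymm
  · rw [← phi_pow_dvd_prod_iff hd]
    exact ((phi_pow_dvd_prod_iff hd m _).mpr le_rfl).trans (hm.dvd_of_clears _ hm'.clears)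
  · rw [← phi_pow_dvd_prod_iff hd]
    exact ((phi_pow_dvd_prod_iff hd m' _).mpr le_rfl).trans (hm'.dvd_of_clears _ hm.clears)

theorem exists_prod_one_sub_monomial_eq (l : Multiset (Fin r →₀ ℕ)) (hl : ∀ e ∈ l, e ≠ 0) :
    ∃ (s : Finset (Fin r →₀ ℕ)) (b : (Fin r →₀ ℕ) → ℕ), 0 ∉ s ∧
      ((l.map fun e => 1 - monomial e 1).prod : MvPolynomial (Fin r) ℤ) =
        ∏ d ∈ s, phi d ^ b d := by
  classical
  suffices h : ∃ M : Multiset (Fin r →₀ ℕ), 0 ∉ M ∧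
      ((l.map fun e => 1 - monomial e 1).prod : MvPolynomial (Fin r) ℤ) = (M.map phi).prod by
    obtain ⟨M, hM, hprod⟩ := h
    exact ⟨M.toFinset, fun d => M.count d, mt Multiset.mem_toFinset.mp hM,
      hprod.trans (Finset.prod_multiset_map_count M phi)⟩
  induction l using Multiset.induction with
  | empty => exact ⟨0, Multiset.notMem_zero 0, rfl⟩
  | cons e l ih =>
    obtain ⟨M, hM, hprod⟩ := ih fun e he => hl e (Multiset.mem_cons_of_mem he)
    obtain ⟨s, hs, hes⟩ := one_sub_monomial_eq_prod (hl e (Multiset.mem_cons_self e l))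
    refine ⟨s.val + M, fun h => (Multiset.mem_add.mp h).elim hs hM, ?_⟩
    rw [Multiset.map_cons, Multiset.prod_cons, hprod, hes, Multiset.map_add, Multiset.prod_add]
    rfl

theorem ClearsDenominators.smul_quotSeries_mem_bot {B : MvPolynomial (Fin r) ℤ}
    (hB : ClearsDenominators 𝓡 B) {I : Ideal R} (hI : I.IsHomogeneous 𝓡) :
    B • quotSeries 𝓡 I ∈
      (⊥ : Subalgebra (MvPolynomial (Fin r) ℤ) (MvPowerSeries (Fin r) ℤ)) := by
  rw [quotSeries, smul_sub]
  exact sub_mem (smul_mem_bot_iff.mpr (hB.exists_polynomial ⊤ (Ideal.IsHomogeneous.top 𝓡)))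
    (smul_mem_bot_iff.mpr (hB.exists_polynomial I hI))

variable [Algebra.FiniteType K R] [∀ e, Module.Finite K (𝓡 e)] {m : (Fin r →₀ ℕ) →₀ ℕ}

theorem prod_phi_pow_smul_quotSeries_mem_bot
    (hm : ∀ d, (m d : WithBot ℕ∞) = ringKrullDim (R ⧸ offLine 𝓡 d)) {I : Ideal R}
    (hI : I.IsHomogeneous 𝓡) : (m.prod fun d a => phi d ^ a) • quotSeries 𝓡 I ∈
      (⊥ : Subalgebra (MvPolynomial (Fin r) ℤ) (MvPowerSeries (Fin r) ℤ)) := by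
  classical
  have := Algebra.FiniteType.isNoetherianRing K R
  obtain ⟨l, hl, hmem⟩ := exists_prod_one_sub_monomial_smul_quotSeries_mem_bot hI
  obtain ⟨s, b, hs, hprod⟩ := exists_prod_one_sub_monomial_eq l fun e he => (hl e he).1
  have hs0 (d) (hd : d ∈ s) : d ≠ 0 := fun h => hs (h ▸ hd)
  have hpole (d) (hd : d ∈ s) : PoleOrderLE (phi d) (m d) (quotSeries 𝓡 I) :=
    poleOrderLE_quotSeries (hs0 d hd) hI
      ((ringKrullDim_quotient_antitone le_sup_right).trans_eq (hm d).symm)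
  rw [hprod, ← mul_one (∏ d ∈ s, _)] at hmem
  have hclear := prod_pow_smul_mem_bot (fun d hd => prime_phi (hs0 d hd)) hpole b hmem
  obtain ⟨C, hC⟩ : ∏ d ∈ s, phi d ^ m d ∣ m.prod fun d a => phi d ^ a := by
    rw [Finsupp.prod_of_support_subset m (Finset.subset_union_right (s₁ := s)) _
      fun _ _ => pow_zero _]
    exact Finset.prod_dvd_prod_of_subset _ _ _ Finset.subset_union_left
  rw [mul_one] at hclear
  rw [hC, mul_comm, mul_smul]
  exact Subalgebra.smul_mem _ hclear C

theorem clearsDenominators_prod_phi_pow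
    (hm : ∀ d, (m d : WithBot ℕ∞) = ringKrullDim (R ⧸ offLine 𝓡 d)) :
    ClearsDenominators 𝓡 (m.prod fun d a => phi d ^ a) where
  constantCoeff_eq_one := by simp [Finsupp.prod, constantCoeff_phi]
  exists_polynomial N hN := by
    rw [← smul_mem_bot_iff, hilbertSeries_eq_quotSeries_bot_sub, smul_sub]
    exact sub_mem (prod_phi_pow_smul_quotSeries_mem_bot hm (Ideal.IsHomogeneous.bot 𝓡))
      (prod_phi_pow_smul_quotSeries_mem_bot hm hN)

theorem ClearsDenominators.phi_pow_dvd {B : MvPolynomial (Fin r) ℤ} (hB : ClearsDenominators 𝓡 B)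
    {d : Fin r →₀ ℕ} (hd : d ≠ 0) {n : ℕ} (hn : (n : WithBot ℕ∞) ≤ ringKrullDim (R ⧸ offLine 𝓡 d)) :
    phi d ^ n ∣ B := by
  have hB0 : B ≠ 0 := by
    rintro rfl
    simpa using hB.constantCoeff_eq_one
  obtain ⟨k, C, hC, rfl⟩ := WfDvdMonoid.max_power_factor' hB0 (prime_phi hd).not_isUnit
  have hdim := ringKrullDim_quotient_offLine_le hd
    ⟨C, hC, hB.smul_quotSeries_mem_bot isHomogeneous_offLine⟩
  exact (pow_dvd_pow _ (by exact_mod_cast hn.trans hdim)).mul_right C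

theorem exists_isUDenom [Nontrivial R] : ∃ m : (Fin r →₀ ℕ) →₀ ℕ,
    IsUDenom 𝓡 (m.prod fun d a => phi d ^ a) ∧
      ∀ d, (m d : WithBot ℕ∞) = ringKrullDim (R ⧸ offLine 𝓡 d) := by
  obtain ⟨m, hm0, hm⟩ := exists_finsupp_eq_ringKrullDim_offLine 𝓡
  have ne_zero {d} (hd : d ∈ m.support) : d ≠ 0 := by
    rintro rfl
    exact Finsupp.mem_support_iff.mp hd hm0
  refine ⟨m, ⟨clearsDenominators_prod_phi_pow hm, fun B hB => ?_⟩, hm⟩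
  refine Finset.prod_dvd_of_isRelPrime (fun d hd e he hde => ?_) fun d hd =>
    hB.phi_pow_dvd (ne_zero hd) (hm d).le
  exact IsRelPrime.pow <| (prime_phi (ne_zero hd)).irreducible.isRelPrime_iff_not_dvd.mpr
    fun h => hde (eq_of_phi_dvd_phi (ne_zero hd) (ne_zero he) h)

end UniversalDenominator

section Torus

variable {K : Type*} [Field K] {r : ℕ} {d e : Fin r →₀ ℕ}

theorem character_smul (n : ℕ) (d : Fin r →₀ ℕ) (t : Fin r → Kˣ) :
    character (n • d) t = character d t ^ n := by
  simp [character, ← Finset.prod_pow, pow_mul']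

theorem character_zpow (e : Fin r →₀ ℕ) (a : Fin r → ℤ) (s : Kˣ) :
    character e (fun i => s ^ a i) = s ^ Finsupp.weight a e := by
  have hsum : s ^ Finsupp.weight a e = ∏ i, s ^ (e i • a i) := by
    rw [Finsupp.weight_eq_sum]
    exact map_sum (zmultiplesHom (Additive Kˣ) (Additive.ofMul s)) _ Finset.univ
  rw [hsum]
  change ∏ i, (s ^ a i) ^ e i = _
  refine Finset.prod_congr rfl fun i _ => ?_
  rw [nsmul_eq_mul, mul_comm, zpow_mul, zpow_natCast]

theorem eq_zero_of_forall_zpow_eq_one [Infinite K] {n : ℤ} (h : ∀ s : Kˣ, s ^ n = 1) : n = 0 := by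
  classical
  by_contra hn
  obtain ⟨x, hx⟩ := Infinite.exists_notMem_finset
    (insert 0 (Polynomial.nthRoots n.natAbs (1 : K)).toFinset)
  simp only [Finset.mem_insert, Multiset.mem_toFinset, not_or,
    Polynomial.mem_nthRoots (Int.natAbs_pos.mpr hn)] at hx
  exact hx.2 (congrArg Units.val (pow_natAbs_eq_one.mpr (h (Units.mk0 x hx.1))))

theorem transverse_eq_zero_of_torusKer_le [Infinite K] (v : PrimitiveVector r) {k : ℕ}
    (h : torusKer K (k • v.vec) ≤ torusKer K e) : v.transverse e = 0 := by
  ext j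
  have hcochar (a : Fin r →₀ ℕ) : Finsupp.weight (fun i => v.transverseUnit i j) a =
      v.transverse a j := by
    simp [PrimitiveVector.transverse, Finsupp.weight_eq_sum]
  refine eq_zero_of_forall_zpow_eq_one (K := K) fun s => ?_
  rw [← hcochar, ← character_zpow]
  refine h (MonoidHom.mem_ker.mpr ?_)
  rw [character_zpow, hcochar, map_nsmul, v.transverse_vec, smul_zero, Pi.zero_apply, zpow_zero]

theorem dvd_height_of_torusKer_le (v : PrimitiveVector r) {k : ℕ} {u : Kˣ}
    (hu : IsPrimitiveRoot u k) (h : torusKer K (k • v.vec) ≤ torusKer K e) :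
    (k : ℤ) ∣ v.height e := by
  rw [← hu.zpow_eq_one_iff_dvd, PrimitiveVector.height, ← character_zpow]
  refine h (MonoidHom.mem_ker.mpr ?_)
  rw [character_zpow, ← PrimitiveVector.height, map_nsmul, v.height_vec, nsmul_one, zpow_natCast,
    hu.pow_eq_one]

theorem torusKer_le_torusKer_iff [IsAlgClosed K] (p : ℕ) [CharP K p] (hd : ¬ ∀ i, p ∣ d i) :
    torusKer K d ≤ torusKer K e ↔ e ∈ AddSubmonoid.multiples d := by
  constructor
  · have hd0 : d ≠ 0 := by
      rintro rfl
      exact hd fun _ => dvd_zero p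
    intro h
    have : NeZero (vecGcd d : K) := ⟨fun h0 => hd fun i =>
      ((CharP.cast_eq_zero_iff K p _).mp h0).trans (vecGcd_dvd d i)⟩
    obtain ⟨η, hη⟩ := HasEnoughRootsOfUnity.exists_primitiveRoot K (vecGcd d)
    obtain ⟨u, rfl⟩ := hη.isUnit (vecGcd_pos hd0).ne'
    obtain ⟨v, hv⟩ := exists_eq_vecGcd_smul_vec hd0
    have : Infinite K := IsAlgClosed.instInfinite
    generalize vecGcd d = k at *
    subst hv
    exact v.mem_multiples_smul_vec_iff.mpr ⟨transverse_eq_zero_of_torusKer_le v h,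
      dvd_height_of_torusKer_le v (IsPrimitiveRoot.coe_units_iff.mp hη) h⟩
  · rintro ⟨n, rfl⟩ t ht
    exact (character_smul n d t).trans ((congrArg (· ^ n) ht).trans (one_pow n))

theorem GeneratesDense.character_eq_one_iff_le {ζ : Fin r → Kˣ} (hζ : GeneratesDense d ζ) :
    character e ζ = 1 ↔ torusKer K d ≤ torusKer K e := by
  refine ⟨fun he t ht => ?_, fun h => h hζ.1⟩
  have heval (s : Fin r → Kˣ) : MvPolynomial.eval (fun i => (s i : K))
      (MvPolynomial.monomial e 1 - 1) = (character e s : K) - 1 := by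
    rw [map_sub, MvPolynomial.eval_monomial, Finsupp.prod_fintype _ _ fun _ => pow_zero _]
    simp [character]
  have hzero : MvPolynomial.eval (fun i => (t i : K)) (MvPolynomial.monomial e 1 - 1) = 0 := by
    refine hζ.2.ge ht _ fun s hs => ?_
    obtain ⟨k, rfl⟩ := Subgroup.mem_zpowers_iff.mp hs
    rw [heval, map_zpow, he, one_zpow, Units.val_one, sub_self]
  rw [heval, sub_eq_zero] at hzero
  exact Units.ext hzero

theorem GeneratesDense.character_eq_one_iff [IsAlgClosed K] (p : ℕ) [CharP K p]
    (hd : ¬ ∀ i, p ∣ d i) {ζ : Fin r → Kˣ} (hζ : GeneratesDense d ζ) :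
    character e ζ = 1 ↔ e ∈ AddSubmonoid.multiples d :=
  hζ.character_eq_one_iff_le.trans (torusKer_le_torusKer_iff p hd)

end Torus

section Points

variable {K S : Type*} [Field K] [CommRing S] [Algebra K S]

theorem algHom_eq_of_ker_eq {y z : S →ₐ[K] K} (h : RingHom.ker y = RingHom.ker z) : y = z := by
  ext x
  have hx : x - algebraMap K S (y x) ∈ RingHom.ker y := by simp [RingHom.mem_ker]
  rw [h, RingHom.mem_ker, map_sub, AlgHom.commutes, sub_eq_zero] at hx
  exact hx.symm

theorem exists_ker_eq_of_isMaximal [IsAlgClosed K] [Algebra.FiniteType K S] (m : Ideal S)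
    [m.IsMaximal] : ∃ y : S →ₐ[K] K, RingHom.ker y = m := by
  let _ : Field (S ⧸ m) := Ideal.Quotient.field m
  have : Module.Finite K (S ⧸ m) := finite_of_finite_type_of_isJacobsonRing K (S ⧸ m)
  let φ : S ⧸ m →ₐ[K] K := IsAlgClosed.lift
  refine ⟨φ.comp (Ideal.Quotient.mkₐ K m), ?_⟩
  ext x
  rw [RingHom.mem_ker, AlgHom.comp_apply, map_eq_zero, Ideal.Quotient.mkₐ_eq_mk,
    Ideal.Quotient.eq_zero_iff_mem]

theorem mem_vanishingIdeal {Z : Set (S →ₐ[K] K)} {f : S} :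
    f ∈ vanishingIdeal Z ↔ ∀ y ∈ Z, y f = 0 := by
  simp [vanishingIdeal, Submodule.mem_iInf, RingHom.mem_ker]

theorem vanishingIdeal_setOf_le_ker [IsAlgClosed K] [Algebra.FiniteType K S] (I : Ideal S) :
    vanishingIdeal {y : S →ₐ[K] K | I ≤ RingHom.ker y} = I.radical := by
  have : IsJacobsonRing S := isJacobsonRing_of_finiteType (A := K)
  refine le_antisymm (fun f hf => ?_) (le_iInf₂ fun y hy => ?_)
  · rw [Ideal.radical_eq_jacobson, Ideal.jacobson, Ideal.mem_sInf]
    rintro m ⟨hIm, hm⟩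
    obtain ⟨y, rfl⟩ := exists_ker_eq_of_isMaximal (K := K) m
    exact mem_vanishingIdeal.mp hf y hIm
  · exact (RingHom.ker_isPrime y).radical_le_iff.mpr hy

theorem vanishingIdeal_iUnion {ι : Type*} (Z : ι → Set (S →ₐ[K] K)) :
    vanishingIdeal (⋃ i, Z i) = ⨅ i, vanishingIdeal (Z i) :=
  iInf_iUnion Z _

end Points

section Dimension

theorem isGreatest_ringKrullDim_quotient_iInf {R ι : Type*} [CommRing R] [Finite ι] [Nonempty ι]
    (I : ι → Ideal R) :
    IsGreatest (Set.range fun i => ringKrullDim (R ⧸ I i)) (ringKrullDim (R ⧸ ⨅ i, I i)) := by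
  have := Fintype.ofFinite ι
  have hle (i) : ringKrullDim (R ⧸ I i) ≤ ringKrullDim (R ⧸ ⨅ i, I i) :=
    ringKrullDim_quotient_antitone (iInf_le I i)
  obtain ⟨i₀, hi₀⟩ := Finite.exists_max fun i => ringKrullDim (R ⧸ I i)
  refine ⟨⟨i₀, (hle i₀).antisymm ?_⟩, Set.forall_mem_range.mpr hle⟩
  refine ringKrullDim_quotient_le_of_forall_prime fun P hP hIP => ?_
  rw [← Finset.inf_univ_eq_iInf, hP.inf_le'] at hIP
  obtain ⟨i, -, hi⟩ := hIP
  exact (ringKrullDim_quotient_antitone hi).trans (hi₀ i)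

theorem isGreatest_algDim_iUnion {K S ι : Type*} [Field K] [CommRing S] [Algebra K S] [Finite ι]
    [Nonempty ι] (Z : ι → Set (S →ₐ[K] K)) :
    IsGreatest (Set.range fun i => algDim (Z i)) (algDim (⋃ i, Z i)) := by
  rw [algDim, vanishingIdeal_iUnion]
  exact isGreatest_ringKrullDim_quotient_iInf fun i => vanishingIdeal (Z i)

theorem ringKrullDim_quotient_radical {R : Type*} [CommRing R] (I : Ideal R) :
    ringKrullDim (R ⧸ I.radical) = ringKrullDim (R ⧸ I) := by
  rw [ringKrullDim_quotient, ringKrullDim_quotient, PrimeSpectrum.zeroLocus_radical]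

theorem ringKrullDim_quotient_map_of_isIntegral {R S : Type*} [CommRing R] [CommRing S]
    [Algebra R S] [Algebra.IsIntegral R S] (hinj : Function.Injective (algebraMap R S))
    (I : Ideal R) : ringKrullDim (S ⧸ I.map (algebraMap R S)) = ringKrullDim (R ⧸ I) := by
  rw [ringKrullDim_eq_of_isIntegral (R ⧸ (I.map (algebraMap R S)).comap (algebraMap R S)) _
    Ideal.algebraMap_quotient_injective]
  refine (ringKrullDim_quotient_antitone Ideal.le_comap_map).antisymm ?_
  refine ringKrullDim_quotient_le_of_forall_prime fun P hP hIP =>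
    ringKrullDim_quotient_antitone ?_
  have hker : RingHom.ker (algebraMap R S) ≤ P :=
    ((RingHom.injective_iff_ker_eq_bot _).mp hinj).trans_le bot_le
  obtain ⟨Q, -, -, rfl⟩ := Ideal.exists_ideal_over_prime_of_isIntegral (S := S) P ⊥ hker
  exact Ideal.comap_mono (Ideal.map_le_iff_le_comap.mpr hIP)

end Dimension

section Invariants

variable (G : Type*) {K S : Type*} [Field K] [CommRing S] [Algebra K S] [Group G]
  [MulSemiringAction G S] [SMulCommClass G K S] {r : ℕ} (𝒜 : (Fin r →₀ ℕ) → Submodule K S)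

theorem invGrading_zero (h𝒜 : 𝒜 0 = 1) : invGrading G 𝒜 0 = 1 := by
  ext x
  change (x : S) ∈ 𝒜 0 ↔ _
  rw [h𝒜, Submodule.mem_one, Submodule.mem_one]
  exact exists_congr fun a => ⟨fun hx => Subtype.ext hx, fun hx => congrArg Subtype.val hx⟩

instance isInvariant_fixedPoints : Algebra.IsInvariant (FixedPoints.subalgebra K S G) S G :=
  ⟨fun b hb => ⟨⟨b, hb⟩, rfl⟩⟩

theorem finiteType_fixedPoints [Finite G] [Algebra.FiniteType K S] :
    Algebra.FiniteType K (FixedPoints.subalgebra K S G) := by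
  have := Algebra.IsInvariant.isIntegral (FixedPoints.subalgebra K S G) S G
  have : Algebra.FiniteType (FixedPoints.subalgebra K S G) S :=
    Algebra.FiniteType.of_restrictScalars_finiteType K _ S
  have hfinite : Module.Finite (FixedPoints.subalgebra K S G) S := Algebra.IsIntegral.finite
  exact ⟨fg_of_fg_of_fg K (FixedPoints.subalgebra K S G) S Algebra.FiniteType.out hfinite.fg_top
    Subtype.val_injective⟩

variable {G}

theorem exists_groupPoint_eq_iff [Finite G] {y z : S →ₐ[K] K} :
    (∃ g : G, groupPoint g y = z) ↔ ∀ f : FixedPoints.subalgebra K S G, z f = y f := by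
  constructor
  · rintro ⟨g, rfl⟩ f
    exact congrArg y (f.2 g⁻¹)
  · intro h
    have hunder : (RingHom.ker y).under (FixedPoints.subalgebra K S G) =
        (RingHom.ker z).under (FixedPoints.subalgebra K S G) := by
      ext f
      change y f = 0 ↔ z f = 0
      rw [h]
    have : (RingHom.ker y).IsPrime := RingHom.ker_isPrime y
    have : (RingHom.ker z).IsPrime := RingHom.ker_isPrime z
    obtain ⟨g, hg⟩ := Algebra.IsInvariant.exists_smul_of_under_eq
      (FixedPoints.subalgebra K S G) S G _ _ hunder
    refine ⟨g, algHom_eq_of_ker_eq ?_⟩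
    rw [hg]
    ext x
    rw [Ideal.mem_pointwise_smul_iff_inv_smul_mem]
    rfl

variable [GradedAlgebra 𝒜]

theorem torusPoint_apply_eq_iff {ζ : Fin r → Kˣ} {y : S →ₐ[K] K} {e : Fin r →₀ ℕ} {f : S}
    (hf : f ∈ 𝒜 e) : torusPoint 𝒜 ζ y f = y f ↔ character e ζ ≠ 1 → y f = 0 := by
  rw [torusPoint, AlgHom.comp_apply, torusAct_of_mem 𝒜 _ hf, map_inv, map_smul, smul_eq_mul,
    mul_left_eq_self₀, Units.val_eq_one, inv_eq_one, or_iff_not_imp_left]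

variable [GradedAction G 𝒜]

theorem forall_torusPoint_apply_eq_iff {ζ : Fin r → Kˣ} {y : S →ₐ[K] K} :
    (∀ f : FixedPoints.subalgebra K S G, torusPoint 𝒜 ζ y f = y f) ↔
      ∀ e, character e ζ ≠ 1 → ∀ f ∈ invGrading G 𝒜 e, y (f : S) = 0 := by
  refine ⟨fun h e he f hf => (torusPoint_apply_eq_iff 𝒜 hf).mp (h f) he, fun h f => ?_⟩
  induction f using DirectSum.Decomposition.inductionOn (invGrading G 𝒜) with
  | zero => rw [ZeroMemClass.coe_zero, map_zero, map_zero]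
  | @homogeneous e f => exact (torusPoint_apply_eq_iff 𝒜 f.2).mpr fun he => h e he f f.2
  | add f g hf hg => rw [AddMemClass.coe_add, map_add, map_add, hf, hg]

variable {d : Fin r →₀ ℕ} {ζ : Fin r → Kˣ}
  (hζ : ∀ e, character e ζ = 1 ↔ e ∈ AddSubmonoid.multiples d)

include hζ in
theorem iUnion_eigenLocus_eq [Finite G] :
    ⋃ g : G, eigenLocus 𝒜 g ζ =
      {y | (offLine (invGrading G 𝒜) d).map (algebraMap _ S) ≤ RingHom.ker y} := by
  ext y
  simp only [Set.mem_iUnion, eigenLocus, Set.mem_ofPred_eq]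
  rw [exists_groupPoint_eq_iff, forall_torusPoint_apply_eq_iff, Ideal.map_le_iff_le_comap,
    offLine_le_iff]
  exact forall_congr' fun e => imp_congr (not_congr (hζ e)) Iff.rfl

include hζ in
theorem isGreatest_algDim_eigenLocus [Finite G] [IsAlgClosed K] [Algebra.FiniteType K S] :
    IsGreatest (Set.range fun g : G => algDim (eigenLocus 𝒜 g ζ))
      (ringKrullDim (FixedPoints.subalgebra K S G ⧸ offLine (invGrading G 𝒜) d)) := by
  have := Algebra.IsInvariant.isIntegral (FixedPoints.subalgebra K S G) S G
  have hdim : algDim (⋃ g : G, eigenLocus 𝒜 g ζ) =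
      ringKrullDim (FixedPoints.subalgebra K S G ⧸ offLine (invGrading G 𝒜) d) := by
    rw [iUnion_eigenLocus_eq 𝒜 hζ, algDim, vanishingIdeal_setOf_le_ker,
      ringKrullDim_quotient_radical, ringKrullDim_quotient_map_of_isIntegral Subtype.val_injective]
  exact hdim ▸ isGreatest_algDim_iUnion fun g : G => eigenLocus 𝒜 g ζ

end Invariants

end UDenom

end

open UDenom in
theorem mainTheorem5 {K S G : Type*} [Field K] [IsAlgClosed K] (p : ℕ) [CharP K p]
    [CommRing S] [Nontrivial S] [Algebra K S] [Algebra.FiniteType K S]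
    {r : ℕ} (𝒜 : (Fin r →₀ ℕ) → Submodule K S) [GradedAlgebra 𝒜]
    (h𝒜 : 𝒜 0 = 1)
    [Group G] [Finite G] [MulSemiringAction G S] [SMulCommClass G K S] [GradedAction G 𝒜] :
    (∃ m : (Fin r →₀ ℕ) →₀ ℕ, IsUDenom (invGrading G 𝒜) (m.prod fun d a => phi d ^ a)) ∧
    ∀ m : (Fin r →₀ ℕ) →₀ ℕ, IsUDenom (invGrading G 𝒜) (m.prod fun d a => phi d ^ a) →
      ∀ d : Fin r →₀ ℕ, ¬ (∀ i, p ∣ d i) →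
        ∀ ζ : Fin r → Kˣ, GeneratesDense d ζ →
          IsGreatest (Set.range fun g : G => algDim (eigenLocus 𝒜 g ζ))
            ((m d : ℕ) : WithBot ℕ∞) := by
  have := finiteType_fixedPoints G (K := K) (S := S)
  have := Algebra.FiniteType.isNoetherianRing K (FixedPoints.subalgebra K S G)
  have := finite_gradedPiece (invGrading G 𝒜) (invGrading_zero G 𝒜 h𝒜)
  obtain ⟨m₀, hm₀, hdim⟩ := exists_isUDenom (𝓡 := invGrading G 𝒜)
  refine ⟨⟨m₀, hm₀⟩, fun m hm d hd ζ hζ => ?_⟩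
  have hd0 : d ≠ 0 := by
    rintro rfl
    exact hd fun _ => dvd_zero p
  rw [hm.apply_eq hm₀ hd0, hdim]
  exact isGreatest_algDim_eigenLocus 𝒜 fun e => hζ.character_eq_one_iff p hd
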